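/- Let $q$ be a prime power, $\mathrm{GL}_n(\mathbf F_q)$ the general linear group, and $\mathrm L_n^*(\mathbf F_q)$ the poset of nonzero proper subspaces of $\mathbf F_q^n$. For a prime $p$ and $r\ge 1$ the $r$th $p$-primary equivariant reduced Euler characteristic is $$\widetilde\chi_r^p(n,q)=\frac1{|\mathrm{GL}_n(\mathbf F_q)|}\sum_{X}\widetilde\chi\big(C_{\mathrm L_n^*(\mathbf F_q)}(X(\mathbf Z\times\mathbf Z_p^{r-1}))\big),$$ where $X$ runs through all homomorphisms $\mathbf Z\times\mathbf Z_p^{r-1}\to\mathrm{GL}_n(\mathbf F_q)$ ($\mathbf Z_p$ the $p$-adic integers), $C_{\mathrm L_n^*(\mathbf F_q)}(H)$ is the subposet of $H$-invariant subspaces, and $\widetilde\chi$ is the reduced Euler characteristic (with $\widetilde\chi(\emptyset)=-1$). The $r$th $p$-primary generating function at $q$ is the power series $F_r^p(x)(q)=1+\sum_{n\ge1}\widetilde\chi_r^p(n,q)x^n$. Let $P_2(x)=\prod_{n\ge0}(1-x^{2^n})^{-1}$ be the generating function of the number of partitions of natural numbers into powers of $2$. Two integers prime to $2$ are called $2$-equivalent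 if they generate subgroups of $\mathbf Z_2^\times$ with the same closure. For $e\ge 0$ and a sign $\pm$, write $F_2^2(x)(\pm3^{2^e})$ for the common value of $F_2^2(x)(q)$ at all prime powers $q$ that are $2$-equivalent to $\pm3^{2^e}$ (such $q$ exist). Then $$F^2_2(x)(-3^{2^e})=\begin{cases}\dfrac{(1-x)^2}{P_2(x)^2}& e=0\\[2ex] \dfrac{1-x}{1+x}\Big(\dfrac{1+x}{P_2(x)}\Big)^{2^{1+e}}& e>0\end{cases}\qquad F^2_2(x)(3^{2^e})=\begin{cases}\dfrac{1-x^2}{P_2(x)^2}& e=0\\[2ex] \Big(\dfrac{1-x}{P_2(x)}\Big)^{2^{1+e}}& e>0.\end{cases}$$ -/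

import Mathlib

open PowerSeries

/-- The reduced Euler characteristic of a finite poset `P`, i.e. of its order complex: the
alternating sum over all chains of `P`, a chain with `k` elements being a simplex of dimension
`k - 1` and contributing `(-1) ^ (k - 1) = (-1) ^ (k + 1)`. The empty chain is included, so the
empty poset has reduced Euler characteristic `-1`. -/
noncomputable def reducedEulerChar (P : Type*) [PartialOrder P] : ℤ :=
  ∑ᶠ c : {c : Finset P // IsChain (· ≤ ·) (c : Set P)}, (-1 : ℤ) ^ (c.1.card + 1)

/-- The group `ℤ × ℤ_p ^ (r - 1)` for `r ≥ 1`, written multiplicatively. -/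
abbrev PrimaryGroup (p : ℕ) [Fact p.Prime] (r : ℕ) : Type :=
  Multiplicative (ℤ × (Fin (r - 1) → ℤ_[p]))

/-- There are only finitely many homomorphisms from `ℤ × ℤ_p ^ (r - 1)` to a finite group, so that
the sum in the next definition is an honest finite sum. (All of them are continuous.) -/
theorem finite_primaryGroup_hom (p : ℕ) [Fact p.Prime] (r : ℕ) (G : Type*) [Group G] [Finite G] :
    Finite (PrimaryGroup p r →* G) := by
  classical
  obtain ⟨k, u, hu, hm⟩ :=
    Nat.exists_eq_pow_mul_and_not_dvd (Nat.card_pos (α := G)).ne' p (Fact.out : p.Prime).ne_one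
  have hunit : IsUnit ((u : ℕ) : ℤ_[p]) := by
    rw [PadicInt.isUnit_iff]
    by_contra h
    exact hu ((PadicInt.norm_natCast_lt_one_iff).1 (lt_of_le_of_ne (PadicInt.norm_le_one _) h))
  -- every element is an integral combination of the standard generators up to multiples of `|G|`
  have key : ∀ x : ℤ_[p], ∃ (a : ℕ) (y : ℤ_[p]), x = a • (1 : ℤ_[p]) + (Nat.card G) • y := by
    intro x
    obtain ⟨z, hz⟩ := Ideal.mem_span_singleton'.1 (PadicInt.appr_spec k x)
    obtain ⟨v, hv⟩ := hunit.exists_left_inv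
    refine ⟨x.appr k, z * v, ?_⟩
    rw [hm]
    push_cast [nsmul_eq_mul]
    linear_combination -hz - z * (p : ℤ_[p]) ^ k * hv
  choose a y hay using key
  let e : Fin (r - 1) → PrimaryGroup p r := fun i => Multiplicative.ofAdd (0, Pi.single i 1)
  let b : PrimaryGroup p r := Multiplicative.ofAdd (1, 0)
  refine Finite.of_injective
    (fun f : PrimaryGroup p r →* G => ((f b, fun i => f (e i)) : G × (Fin (r - 1) → G))) ?_
  intro f g hfg
  simp only [Prod.mk.injEq] at hfg
  obtain ⟨h1, h2⟩ := hfg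
  ext x
  obtain ⟨n, w⟩ := x
  have hx : (Multiplicative.ofAdd ((n, w) : ℤ × (Fin (r - 1) → ℤ_[p])) : PrimaryGroup p r)
      = b ^ n * (∏ i, e i ^ a (w i)) *
        (Multiplicative.ofAdd ((0, fun i => y (w i)) : ℤ × (Fin (r - 1) → ℤ_[p])))
          ^ Nat.card G := by
    apply Multiplicative.toAdd.injective
    simp only [toAdd_mul, toAdd_zpow, toAdd_pow, toAdd_prod, b, e, toAdd_ofAdd]
    ext i
    · simp [Prod.fst_sum]
    · simp only [Prod.snd_add, Prod.snd_sum, Prod.smul_snd, Pi.add_apply, Pi.smul_apply,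
        Finset.sum_apply, smul_zero, zero_add]
      rw [Finset.sum_eq_single i (fun j _ hj => by simp [Pi.single_eq_of_ne hj.symm])
        (by simp), Pi.single_eq_same]
      exact hay (w i)
  have hall : ∀ h : PrimaryGroup p r →* G,
      h (Multiplicative.ofAdd ((n, w) : ℤ × (Fin (r - 1) → ℤ_[p])))
        = h b ^ n * h (∏ i, e i ^ a (w i)) := by
    intro h
    rw [hx, map_mul, map_mul, map_zpow, map_pow, pow_card_eq_one', mul_one]
  have hprod : f (∏ i, e i ^ a (w i)) = g (∏ i, e i ^ a (w i)) := by
    have : ∀ s : Finset (Fin (r - 1)), f (∏ i ∈ s, e i ^ a (w i)) = g (∏ i ∈ s, e i ^ a (w i)) := by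
      intro s
      induction s using Finset.induction_on with
      | empty => simp
      | insert i s hi ih =>
        rw [Finset.prod_insert hi, map_mul, map_mul, ih, map_pow, map_pow, congrFun h2 i]
    exact this _
  exact (hall f).trans ((by rw [h1, hprod] : _ = _).trans (hall g).symm)

/-- The `r`th `p`-primary equivariant reduced Euler characteristic (`r ≥ 1`) of a finite poset `P`
with an action of a finite group `G`:
`|G|⁻¹ ∑_X χ̃(C_P(X(ℤ × ℤ_p ^ (r - 1))))`, where `X` runs through all homomorphisms from
`ℤ × ℤ_p ^ (r - 1)` to `G` and `C_P(H)` is the subposet of elements of `P` fixed by `H`. -/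
noncomputable def primaryEquivariantEulerChar (p : ℕ) [Fact p.Prime] (r : ℕ)
    (P : Type*) [PartialOrder P] (G : Type*) [Group G] [MulAction G P] : ℚ :=
  (Nat.card G : ℚ)⁻¹ *
    ∑ᶠ X : PrimaryGroup p r →* G, (reducedEulerChar (MulAction.fixedPoints X.range P) : ℚ)

/-- The poset `L*(V)` of nonzero proper subspaces of `V`, ordered by inclusion. -/
abbrev ProperSubspace (F V : Type*) [Field F] [AddCommGroup V] [Module F V] : Type _ :=
  {U : Submodule F V // U ≠ ⊥ ∧ U ≠ ⊤}

/-- The general linear group acts on the poset of nonzero proper subspaces by `g • U = g(U)`. -/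
instance properSubspaceMulAction (F V : Type*) [Field F] [AddCommGroup V] [Module F V] :
    MulAction (LinearMap.GeneralLinearGroup F V) (ProperSubspace F V) where
  smul g U := ⟨U.1.map (LinearMap.GeneralLinearGroup.toLinearEquiv g : V →ₗ[F] V), by
    refine ⟨fun h => U.2.1 ?_, fun h => U.2.2 ?_⟩
    · exact Submodule.map_eq_bot_iff.1 h
    · exact (Submodule.map_eq_top_iff).1 h⟩
  one_smul U := Subtype.ext (Submodule.map_id U.1)
  mul_smul g h U := Subtype.ext
    (Submodule.map_comp (LinearMap.GeneralLinearGroup.toLinearEquiv h : V →ₗ[F] V)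
      (LinearMap.GeneralLinearGroup.toLinearEquiv g : V →ₗ[F] V) U.1)

/-- The `r`th `p`-primary generating function `F_r^p(x)(q) = 1 + ∑_{n ≥ 1} χ̃_r^p(n,q) x ^ n` at
`q = |F|`, where `χ̃_r^p(n,q)` is the `r`th `p`-primary equivariant reduced Euler characteristic of
the `GL_n(F)`-poset `L*(F ^ n)`. -/
noncomputable def primaryGenFun (p : ℕ) [Fact p.Prime] (r : ℕ) (F : Type*) [Field F] : ℚ⟦X⟧ :=
  PowerSeries.mk fun n =>
    if n = 0 then 1
    else primaryEquivariantEulerChar p r (ProperSubspace F (Fin n → F))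
      (LinearMap.GeneralLinearGroup F (Fin n → F))

/-- The generating function `P_p(x)` of the number of partitions of natural numbers into powers
`p ^ k`, `k ≥ 0`, of `p`; that is, `P_p(x) = ∏_{k ≥ 0} (1 - x ^ (p ^ k))⁻¹` for `p ≥ 2`. -/
noncomputable def powerPartitionGenFun (p : ℕ) : ℚ⟦X⟧ :=
  PowerSeries.mk fun n =>
    (Nat.card {l : Nat.Partition n // ∀ i ∈ l.parts, ∃ k : ℕ, i = p ^ k} : ℚ)

/-- Two integers are `p`-equivalent if both are units of the ring `ℤ_p` of `p`-adic integers and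
the closures in `ℤ_pˣ` of the subgroups that they generate agree. -/
def PAdicEquivalent (p : ℕ) [Fact p.Prime] (a b : ℤ) : Prop :=
  ∃ u v : ℤ_[p]ˣ, (u : ℤ_[p]) = a ∧ (v : ℤ_[p]) = b ∧
    closure (Subgroup.zpowers u : Set ℤ_[p]ˣ) = closure (Subgroup.zpowers v : Set ℤ_[p]ˣ)

/-! ### Sums over finite index types. -/

section FiniteSums

variable {ι M : Type*} [AddCommMonoid M]

/-! Homomorphisms `ℤ × ℤ_p → GL_n(F)` are commuting pairs `(g, h)` with `h` of `p`-power order, and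
the fixed poset consists of the subspaces invariant under both. For fixed `n` and large `N`, having
`p`-power order means being annihilated by `f = X ^ p ^ N - 1`. This `f` is squarefree because `p`
is not the characteristic, so every such `h` is semisimple.

Möbius numbers of lattices of invariant subspaces, summed over all invariant `U`, cancel. Sum this
recursion over the centralizer `C(h)`. An automorphism in `C(h)` preserving `U` is the same as its
restriction to `U`, an `h`-invariant complement `W` of `U` and an element of `C(h|W)`. Hence `∑_{V =
U ⊕ W} M(h|U) |C(h|W)| = 0`, where `M(h)` is the sum of the Möbius numbers over `C(h)`. Summing over
`h` and dividing by `|GL_n|` turns this into `moebiusSeries f * centralizerSeries f = 1`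
(`moebiusSeries_mul_centralizerSeries`).

The second series only counts commuting pairs. It is multiplicative over coprime factors by primary
decomposition (`centralizerSeries_mul`). For an irreducible polynomial of degree `d` it is `1 / (1 -
x ^ d)` by orbit-stabilizer (`centralizerSeries_mul_of_irreducible`). So `moebiusSeries f` is the
product of `1 - x ^ deg P` over the irreducible factors `P` of `f`. The factors of the `p ^ j`-th
cyclotomic polynomial have degree `d_j`, the order of `q` modulo `p ^ j`, so the generating function
is the limit of `∏_j (1 - x ^ d_j) ^ (φ(p ^ j) / d_j)`. The `d_j` depend only on the `p`-adic class
of `q` (`PAdicEquivalent.orderOf_eq`).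

For `p = 2` and `q` equivalent to `±3 ^ 2 ^ e`, the order modulo `2 ^ (e + 3 + i)` is `2 ^ (i + 1)`.
The exponents in this range are constantly `2 ^ (e + 1)`, and the tail is the `2 ^ (e + 1)`-th power
of `1 / ((1 - x) P_2(x))`. Only the factors with `j < e + 3` distinguish the four cases. -/

theorem finsum_sigma_of_finite {κ : ι → Type*} [Finite ι] [∀ i, Finite (κ i)]
    (f : (Σ i, κ i) → M) : ∑ᶠ x, f x = ∑ᶠ i, ∑ᶠ k, f ⟨i, k⟩ := by
  have := Fintype.ofFinite ι
  have := fun i => Fintype.ofFinite (κ i)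
  simp only [finsum_eq_sum_of_fintype]
  exact Fintype.sum_sigma f

theorem finsum_prod_of_finite {κ : Type*} [Finite ι] [Finite κ] (f : ι × κ → M) :
    ∑ᶠ x, f x = ∑ᶠ i, ∑ᶠ k, f (i, k) := by
  have := Fintype.ofFinite ι
  have := Fintype.ofFinite κ
  simp only [finsum_eq_sum_of_fintype]
  exact Fintype.sum_prod_type f

theorem finsum_option_of_finite [Finite ι] (f : Option ι → M) :
    ∑ᶠ x, f x = f none + ∑ᶠ i, f (some i) := by
  have := Fintype.ofFinite ι
  simp only [finsum_eq_sum_of_fintype]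
  exact Fintype.sum_option f

theorem finsum_const_of_finite [Finite ι] (a : M) : ∑ᶠ _ : ι, a = Nat.card ι • a := by
  have := Fintype.ofFinite ι
  simp [finsum_eq_sum_of_fintype]

theorem finsum_ite_eq_finsum_subtype [Finite ι] (p : ι → Prop) [DecidablePred p] (f : ι → M) :
    ∑ᶠ i, (if p i then f i else 0) = ∑ᶠ i : {i // p i}, f i := by
  have := Fintype.ofFinite ι
  simp only [finsum_eq_sum_of_fintype]
  rw [← Finset.sum_filter, Finset.sum_subtype]
  simp

theorem natCast_card_sigma {R : Type*} [NonAssocSemiring R] {κ : ι → Type*} [Finite ι]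
    [∀ i, Finite (κ i)] : (Nat.card (Σ i, κ i) : R) = ∑ᶠ i, (Nat.card (κ i) : R) := by
  rw [← nsmul_one, ← finsum_const_of_finite, finsum_sigma_of_finite]
  simp only [finsum_const_of_finite, nsmul_one]

end FiniteSums

/-! ### Reduced Euler characteristics of finite posets. -/

section EulerCharacteristic

theorem reducedEulerChar_congr {P Q : Type*} [PartialOrder P] [PartialOrder Q] (e : P ≃o Q) :
    reducedEulerChar P = reducedEulerChar Q := by
  refine finsum_eq_of_bijective
    (fun c => ⟨c.1.map e.toEquiv.toEmbedding, by
      rw [Finset.coe_map]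
      rintro _ ⟨x, hx, rfl⟩ _ ⟨y, hy, rfl⟩ hxy
      have := c.2 hx hy (fun h => hxy (by rw [h]))
      simpa using this⟩) ⟨?_, ?_⟩ (fun c => by simp)
  · intro c d h
    simpa [Subtype.ext_iff] using h
  · rintro ⟨c, hc⟩
    refine ⟨⟨c.map e.symm.toEquiv.toEmbedding, ?_⟩, ?_⟩
    · rw [Finset.coe_map]
      rintro _ ⟨x, hx, rfl⟩ _ ⟨y, hy, rfl⟩ hxy
      have := hc hx hy (fun h => hxy (by rw [h]))
      simpa using this
    · ext x
      simp

/-- Sorting the chains of a finite poset by their greatest elements. -/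
theorem reducedEulerChar_eq_neg_one_sub_finsum (P : Type*) [PartialOrder P] [Finite P] :
    reducedEulerChar P = -1 - ∑ᶠ u : P, reducedEulerChar {x // x < u} := by
  classical
  let C (Q : Type _) [PartialOrder Q] := {c : Finset Q // IsChain (· ≤ ·) (c : Set Q)}
  -- The empty chain has no greatest element; it is the index `none` and accounts for the summand
  -- `-1`.
  let φ : Option (Σ u : P, C {x // x < u}) → C P
    | none => ⟨∅, by simp⟩
    | some ⟨u, c⟩ => ⟨insert u (c.1.map (Function.Embedding.subtype _)), by
        rw [Finset.coe_insert, Finset.coe_map]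
        refine IsChain.insert ?_ ?_
        · rintro _ ⟨x, hx, rfl⟩ _ ⟨y, hy, rfl⟩ hxy
          exact c.2 hx hy (fun h => hxy (by rw [h]))
        · rintro _ ⟨x, hx, rfl⟩ -
          exact Or.inr x.2.le⟩
  have hφ : Function.Bijective φ := by
    constructor
    · rintro (_ | ⟨u, c⟩) (_ | ⟨v, d⟩) h
      · rfl
      · exact absurd (congrArg Subtype.val h).symm (Finset.insert_ne_empty _ _)
      · exact absurd (congrArg Subtype.val h) (Finset.insert_ne_empty _ _)
      · have h' : insert u (c.1.map (Function.Embedding.subtype _)) =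
          insert v (d.1.map (Function.Embedding.subtype _)) := congrArg Subtype.val h
        have huv : u ≤ v := by
          have : u ∈ insert v (d.1.map (Function.Embedding.subtype _)) := by
            rw [← h']; exact Finset.mem_insert_self _ _
          rcases Finset.mem_insert.1 this with h | h
          · exact h.le
          · obtain ⟨x, -, rfl⟩ := Finset.mem_map.1 h
            exact x.2.le
        have hvu : v ≤ u := by
          have : v ∈ insert u (c.1.map (Function.Embedding.subtype _)) := by
            rw [h']; exact Finset.mem_insert_self _ _
          rcases Finset.mem_insert.1 this with h | h
          · exact h.le
          · obtain ⟨x, -, rfl⟩ := Finset.mem_map.1 h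
            exact x.2.le
        obtain rfl := le_antisymm huv hvu
        have hn : ∀ c : C {x // x < u}, u ∉ c.1.map (Function.Embedding.subtype _) := by
          intro c hc
          obtain ⟨x, -, hx⟩ := Finset.mem_map.1 hc
          exact x.2.ne hx
        have := congrArg (fun s => Finset.erase s u) h'
        simp only [Finset.erase_insert (hn _)] at this
        rw [Finset.map_inj] at this
        rw [Subtype.ext this]
    · rintro ⟨c, hc⟩
      rcases c.eq_empty_or_nonempty with rfl | hne
      · exact ⟨none, rfl⟩
      obtain ⟨u, hu⟩ := c.exists_maximal hne
      have hlt : ∀ x ∈ c, x ≠ u → x < u := by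
        intro x hx hxu
        rcases hc hx hu.1 hxu with h | h
        · exact lt_of_le_of_ne h hxu
        · exact absurd (le_antisymm (hu.2 hx h) h) hxu
      refine ⟨some ⟨u, ⟨(c.erase u).subtype (· < u), ?_⟩⟩, Subtype.ext ?_⟩
      · intro x hx y hy hxy
        exact hc (Finset.mem_of_mem_erase (Finset.mem_subtype.1 hx))
          (Finset.mem_of_mem_erase (Finset.mem_subtype.1 hy))
          (fun h => hxy (Subtype.ext h))
      · change insert u (((c.erase u).subtype (· < u)).map (Function.Embedding.subtype _)) = c
        rw [Finset.subtype_map_of_mem, Finset.insert_erase hu.1]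
        intro x hx
        exact hlt x (Finset.mem_of_mem_erase hx) (Finset.ne_of_mem_erase hx)
  have : ∀ u : P, Finite (C {x // x < u}) := fun u => Subtype.finite
  unfold reducedEulerChar
  rw [← finsum_comp φ hφ, finsum_option_of_finite, finsum_sigma_of_finite, sub_eq_add_neg,
    ← finsum_neg_distrib]
  congr 1
  refine finsum_congr fun u => ?_
  rw [← finsum_neg_distrib]
  refine finsum_congr fun c => ?_
  have hn : u ∉ c.1.map (Function.Embedding.subtype _) := by
    intro hc
    obtain ⟨x, -, hx⟩ := Finset.mem_map.1 hc
    exact x.2.ne hx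
  change (-1 : ℤ) ^ ((insert u (c.1.map (Function.Embedding.subtype _))).card + 1) = _
  rw [Finset.card_insert_of_notMem hn, Finset.card_map, pow_succ, mul_neg_one]

end EulerCharacteristic

/-! ### Möbius recursion for invariant subspaces and its sum over a centralizer. -/

section Invariants

open Module

variable {F V V' : Type*} [Field F] [AddCommGroup V] [Module F V] [AddCommGroup V'] [Module F V']

instance finite_end [Finite V] : Finite (End F V) :=
  Finite.of_injective _ DFunLike.coe_injective

/-- The restriction of an endomorphism to an invariant subspace. -/
def invtRestrict (g : End F V) {U : Submodule F V} (hU : U ∈ g.invtSubmodule) : End F U :=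
  g.restrict (fun _ hx => hU hx)

/-- The poset of nonzero proper subspaces invariant under two endomorphisms. -/
abbrev ProperInvariant (g h : End F V) : Type _ :=
  {U : Submodule F V // (U ≠ ⊥ ∧ U ≠ ⊤) ∧ U ∈ g.invtSubmodule ∧ U ∈ h.invtSubmodule}

open Classical in
/-- The Möbius number of the lattice of subspaces invariant under two endomorphisms. -/
noncomputable def invariantMoebius (g h : End F V) : ℤ :=
  -- In the zero space bottom and top coincide, so the Möbius number is `1`, whereas the empty poset
  -- of proper subspaces would give `-1`.
  if Subsingleton V then 1 else reducedEulerChar (ProperInvariant g h)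

theorem map_mem_invtSubmodule {g : End F V} {g' : End F V'} (e : V ≃ₗ[F] V')
    (hg : ∀ v, e (g v) = g' (e v)) {U : Submodule F V} (hU : U ∈ g.invtSubmodule) :
    U.map (e : V →ₗ[F] V') ∈ g'.invtSubmodule := by
  rintro _ ⟨x, hx, rfl⟩
  exact ⟨g x, hU hx, hg x⟩

/-- Conjugate pairs of endomorphisms have isomorphic posets of invariant subspaces. -/
def properInvariantCongr {g h : End F V} {g' h' : End F V'} (e : V ≃ₗ[F] V')
    (hg : ∀ v, e (g v) = g' (e v)) (hh : ∀ v, e (h v) = h' (e v)) :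
    ProperInvariant g h ≃o ProperInvariant g' h' where
  toFun U := ⟨U.1.map (e : V →ₗ[F] V'),
    ⟨by simpa using U.2.1.1, by simpa using U.2.1.2⟩,
    map_mem_invtSubmodule e hg U.2.2.1, map_mem_invtSubmodule e hh U.2.2.2⟩
  invFun U := ⟨U.1.map (e.symm : V' →ₗ[F] V),
    ⟨by simpa using U.2.1.1, by simpa using U.2.1.2⟩,
    map_mem_invtSubmodule e.symm (fun v => by rw [e.symm_apply_eq, hg, e.apply_symm_apply]) U.2.2.1,
    map_mem_invtSubmodule e.symm (fun v => by rw [e.symm_apply_eq, hh, e.apply_symm_apply]) U.2.2.2⟩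
  left_inv U := Subtype.ext (by ext x; simp)
  right_inv U := Subtype.ext (by ext x; simp)
  map_rel_iff' {U W} := Submodule.map_le_map_iff_of_injective e.injective _ _

theorem invariantMoebius_congr {g h : End F V} {g' h' : End F V'} (e : V ≃ₗ[F] V')
    (hg : ∀ v, e (g v) = g' (e v)) (hh : ∀ v, e (h v) = h' (e v)) :
    invariantMoebius g h = invariantMoebius g' h' := by
  unfold invariantMoebius
  rw [reducedEulerChar_congr (properInvariantCongr e hg hh)]
  by_cases hV : Subsingleton V
  · rw [if_pos hV, if_pos (e.toEquiv.subsingleton_congr.1 hV)]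
  · rw [if_neg hV, if_neg (fun h => hV (e.toEquiv.subsingleton_congr.2 h))]

/-- Invariant subspaces of an invariant subspace `U` are the invariant subspaces below `U`. -/
def properInvariantRestrict {g h : End F V} (U : ProperInvariant g h) :
    ProperInvariant (invtRestrict g U.2.2.1) (invtRestrict h U.2.2.2) ≃o
      {W : ProperInvariant g h // W < U} where
  toFun W := ⟨⟨W.1.map U.1.subtype,
      ⟨fun h => W.2.1.1 (Submodule.map_injective_of_injective U.1.subtype_injective
        (h.trans (Submodule.map_bot _).symm)),
      fun h => U.2.1.2 (top_le_iff.1 (h.ge.trans (Submodule.map_subtype_le U.1 W.1)))⟩,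
      by rintro _ ⟨x, hx, rfl⟩; exact ⟨_, W.2.2.1 hx, rfl⟩,
      by rintro _ ⟨x, hx, rfl⟩; exact ⟨_, W.2.2.2 hx, rfl⟩⟩, by
    refine lt_of_le_of_ne (Submodule.map_subtype_le U.1 W.1) fun h => W.2.1.2 ?_
    refine Submodule.map_injective_of_injective U.1.subtype_injective ?_
    rw [Submodule.map_subtype_top]
    exact congrArg Subtype.val h⟩
  invFun W := ⟨W.1.1.comap U.1.subtype, ⟨fun h => W.1.2.1.1 (by
      have h' := congrArg (Submodule.map U.1.subtype) h
      rw [Submodule.map_comap_subtype, Submodule.map_bot] at h'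
      rwa [inf_eq_right.2 (show W.1.1 ≤ U.1 from W.2.le)] at h'), by
      rw [Ne, Submodule.comap_subtype_eq_top]
      exact fun h => not_lt_of_ge h W.2⟩,
      fun x hx => W.1.2.2.1 hx, fun x hx => W.1.2.2.2 hx⟩
  left_inv W := Subtype.ext (Submodule.comap_map_eq_of_injective U.1.subtype_injective _)
  right_inv W := Subtype.ext (Subtype.ext (by
    simpa [Submodule.map_comap_subtype] using W.2.le))
  map_rel_iff' {W W'} := Submodule.map_le_map_iff_of_injective U.1.subtype_injective _ _

/-- The bottom contributes `1`, the top contributes the Euler characteristic of the whole proper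
part, and a proper `U` contributes that of the part strictly below `U`. Sorting chains by greatest
element makes the total vanish. -/
theorem finsum_invariantMoebius_restrict [Finite V] [Nontrivial V] (g h : End F V) :
    ∑ᶠ U : {U : Submodule F V // U ∈ g.invtSubmodule ∧ U ∈ h.invtSubmodule},
      invariantMoebius (invtRestrict g U.2.1) (invtRestrict h U.2.2) = 0 := by
  let φ : Option (Option (ProperInvariant g h)) →
      {U : Submodule F V // U ∈ g.invtSubmodule ∧ U ∈ h.invtSubmodule}
    | none => ⟨⊥, by simp, by simp⟩
    | some none => ⟨⊤, by simp, by simp⟩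
    | some (some U) => ⟨U.1, U.2.2⟩
  have hφ : Function.Bijective φ := by
    constructor
    · rintro (_ | _ | U) (_ | _ | W) h <;>
        replace h := congrArg Subtype.val h
      · rfl
      · exact absurd h bot_ne_top
      · exact absurd h.symm W.2.1.1
      · exact absurd h.symm bot_ne_top
      · rfl
      · exact absurd h.symm W.2.1.2
      · exact absurd h U.2.1.1
      · exact absurd h U.2.1.2
      · rw [Subtype.ext (a1 := U) (a2 := W) h]
    · rintro ⟨U, hU⟩
      by_cases h0 : U = ⊥
      · exact ⟨none, Subtype.ext h0.symm⟩
      by_cases h1 : U = ⊤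
      · exact ⟨some none, Subtype.ext h1.symm⟩
      exact ⟨some (some ⟨U, ⟨h0, h1⟩, hU⟩), rfl⟩
  rw [← finsum_comp φ hφ, finsum_option_of_finite, finsum_option_of_finite]
  have h0 : invariantMoebius (invtRestrict g (φ none).2.1) (invtRestrict h (φ none).2.2) = 1 :=
    if_pos (inferInstanceAs (Subsingleton (⊥ : Submodule F V)))
  have h1 : invariantMoebius (invtRestrict g (φ (some none)).2.1) (invtRestrict h (φ (some none)).2.2) =
      reducedEulerChar (ProperInvariant g h) := by
    rw [invariantMoebius_congr (g' := g) (h' := h) Submodule.topEquiv (fun _ => rfl)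
      (fun _ => rfl)]
    exact if_neg (not_subsingleton V)
  have h2 : ∀ U : ProperInvariant g h,
      invariantMoebius (invtRestrict g (φ (some (some U))).2.1) (invtRestrict h (φ (some (some U))).2.2) =
        reducedEulerChar {W : ProperInvariant g h // W < U} := by
    intro U
    rw [← reducedEulerChar_congr (properInvariantRestrict U)]
    refine if_neg ?_
    rw [not_subsingleton_iff_nontrivial]
    exact Submodule.nontrivial_iff_ne_bot.2 U.2.1.1
  rw [h0, h1, finsum_congr h2, reducedEulerChar_eq_neg_one_sub_finsum (ProperInvariant g h)]
  ring

/-- The injective endomorphisms that commute with `h`. -/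
abbrev InjectiveCentralizer (h : End F V) : Type _ :=
  {g : End F V // Function.Injective g ∧ Commute g h}

/-- The sum of the Möbius numbers `invariantMoebius g h` over the automorphisms `g` commuting
with `h`. -/
noncomputable def centralizerMoebius (h : End F V) : ℤ :=
  ∑ᶠ g : InjectiveCentralizer h, invariantMoebius g.1 h

theorem projectionOnto_apply_of_mem_invtSubmodule {h : End F V} {U W : Submodule F V}
    (hUW : IsCompl U W) (hU : U ∈ h.invtSubmodule) (hW : W ∈ h.invtSubmodule) (v : V) :
    U.projectionOnto W hUW (h v) = invtRestrict h hU (U.projectionOnto W hUW v) := by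
  conv_lhs => rw [← Submodule.projection_add_projection_eq_self hUW v, map_add, map_add]
  rw [(Submodule.projectionOnto_apply_eq_zero_iff hUW).2
      (hW (Submodule.projection_apply_mem hUW.symm v)), add_zero]
  have : h (U.projection W hUW v) = (invtRestrict h hU (U.projectionOnto W hUW v) : V) := rfl
  rw [this, Submodule.projectionOnto_apply_left]

theorem injective_restrict {g : End F V} (hg : Function.Injective g) {U : Submodule F V}
    (hU : U ∈ g.invtSubmodule) : Function.Injective (invtRestrict g hU) :=
  fun _ _ hxy => Subtype.ext (hg (congrArg Subtype.val hxy))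

theorem commute_restrict {g h : End F V} (hgh : Commute g h) {U : Submodule F V}
    (hg : U ∈ g.invtSubmodule) (hh : U ∈ h.invtSubmodule) :
    Commute (invtRestrict g hg) (invtRestrict h hh) :=
  LinearMap.ext fun x => Subtype.ext (LinearMap.congr_fun hgh.eq (x : V))

/-- The automorphisms commuting with `h` and preserving an `h`-invariant subspace `U`, sorted by
their restriction to `U` and the image of a fixed `h`-invariant complement of `U`. -/
theorem finsum_injectiveCentralizer_restrict [Finite V] {h : End F V} {U W₀ : Submodule F V}
    (hU : U ∈ h.invtSubmodule) (h₀ : IsCompl U W₀) (hW₀ : W₀ ∈ h.invtSubmodule)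
    (ψ : End F U → ℤ) :
    ∑ᶠ g : {g : InjectiveCentralizer h // U ∈ g.1.invtSubmodule}, ψ (invtRestrict g.1.1 g.2) =
    ∑ᶠ W : {W : Submodule F V // IsCompl U W ∧ W ∈ h.invtSubmodule},
      (∑ᶠ g : InjectiveCentralizer (invtRestrict h hU), ψ g.1) *
        Nat.card (InjectiveCentralizer (invtRestrict h W.2.2)) := by
  -- From `(g₁, W, k)` build the map that is `g₁` on `U` and, on `W₀`, is the isomorphism `W₀ → W`
  -- along `U` followed by `k`. It carries `W₀` onto `W`, so `W` can be recovered from it.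
  let G (x : InjectiveCentralizer (invtRestrict h hU) ×
      Σ W : {W : Submodule F V // IsCompl U W ∧ W ∈ h.invtSubmodule},
        InjectiveCentralizer (invtRestrict h W.2.2)) : End F V :=
    U.subtype ∘ₗ x.1.1 ∘ₗ U.projectionOnto W₀ h₀ +
      x.2.1.1.subtype ∘ₗ x.2.2.1 ∘ₗ x.2.1.1.projectionOnto U x.2.1.2.1.symm
  have hG : ∀ x v, G x v = (x.1.1 (U.projectionOnto W₀ h₀ v) : V) +
      x.2.2.1 (x.2.1.1.projectionOnto U x.2.1.2.1.symm v) := fun x v => rfl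
  have hGU : ∀ x (u : U), G x u = x.1.1 u := by
    intro x u
    rw [hG, Submodule.projectionOnto_apply_left, Submodule.projectionOnto_apply_right]
    simp
  have hGW : ∀ x (w : W₀), G x w = x.2.2.1 (x.2.1.1.projectionOnto U x.2.1.2.1.symm w) := by
    intro x w
    rw [hG, Submodule.projectionOnto_apply_right]
    simp
  have hG2 : ∀ x, U ∈ (G x).invtSubmodule := by
    intro x u hu
    rw [Submodule.mem_comap, hGU x ⟨u, hu⟩]
    exact (x.1.1 _).2
  have hG1 : ∀ x, Function.Injective (G x) ∧ Commute (G x) h := by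
    intro x
    constructor
    · rw [injective_iff_map_eq_zero]
      intro v hv
      rw [hG] at hv
      have h1 := Submodule.disjoint_def.1 x.2.1.2.1.disjoint _ (Subtype.coe_prop
        (x.1.1 (U.projectionOnto W₀ h₀ v))) (by
          rw [eq_neg_of_add_eq_zero_left hv]; exact neg_mem (Subtype.coe_prop _))
      rw [h1, zero_add] at hv
      have h1' := (map_eq_zero_iff _ x.1.2.1).1 (Subtype.ext h1)
      have h2' := (map_eq_zero_iff _ x.2.2.2.1).1 (Subtype.ext hv)
      rw [Submodule.projectionOnto_apply_eq_zero_iff] at h1' h2'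
      exact Submodule.disjoint_def.1 h₀.disjoint _ h2' h1'
    · refine LinearMap.ext fun v => ?_
      change G x (h v) = h (G x v)
      rw [hG, hG, projectionOnto_apply_of_mem_invtSubmodule h₀ hU hW₀,
        projectionOnto_apply_of_mem_invtSubmodule x.2.1.2.1.symm x.2.1.2.2 hU, map_add]
      congr 1
      · exact congrArg Subtype.val (LinearMap.congr_fun x.1.2.2.eq _)
      · exact congrArg Subtype.val (LinearMap.congr_fun x.2.2.2.2.eq _)
  let Φ : (InjectiveCentralizer (invtRestrict h hU) ×
      Σ W : {W : Submodule F V // IsCompl U W ∧ W ∈ h.invtSubmodule},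
        InjectiveCentralizer (invtRestrict h W.2.2)) →
      {g : InjectiveCentralizer h // U ∈ g.1.invtSubmodule} := fun x => ⟨⟨G x, hG1 x⟩, hG2 x⟩
  have hΦr : ∀ x, invtRestrict (Φ x).1.1 (Φ x).2 = x.1.1 := by
    intro x
    exact LinearMap.ext fun u => Subtype.ext (hGU x u)
  have hΦ : Function.Bijective Φ := by
    constructor
    · rintro x y hxy
      have hG : G x = G y := congrArg (fun z => z.1.1) hxy
      have h1 : x.1 = y.1 := by
        refine Subtype.ext (LinearMap.ext fun u => Subtype.ext ?_)
        rw [← hGU, ← hGU, hG]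
      have hsurj : ∀ (x : InjectiveCentralizer (invtRestrict h hU) ×
          Σ W : {W : Submodule F V // IsCompl U W ∧ W ∈ h.invtSubmodule},
          InjectiveCentralizer (invtRestrict h W.2.2)) (w : x.2.1.1),
          ∃ w₀ : W₀, x.2.1.1.projectionOnto U x.2.1.2.1.symm w₀ = w := by
        intro x w
        refine ⟨W₀.projectionOnto U h₀.symm w, ?_⟩
        rw [Submodule.coe_projectionOnto_apply,
          Submodule.projection_eq_self_sub_projection h₀,
          map_sub, Submodule.projectionOnto_apply_left,
          (Submodule.projectionOnto_apply_eq_zero_iff _).2 (Submodule.projection_apply_mem _ _),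
          sub_zero]
      have hle : ∀ x y, G x = G y → x.2.1.1 ≤ y.2.1.1 := by
        intro x y hxy w hw
        obtain ⟨w', hw'⟩ := (LinearMap.injective_iff_surjective.1 x.2.2.2.1) ⟨w, hw⟩
        obtain ⟨w₀, hw₀⟩ := hsurj x w'
        have := hGW x w₀
        rw [hw₀, hw', hxy, hGW] at this
        change _ = w at this
        rw [← this]
        exact Subtype.coe_prop _
      have h2 : x.2.1 = y.2.1 := Subtype.ext (le_antisymm (hle x y hG) (hle y x hG.symm))
      obtain ⟨x1, W, x2⟩ := x
      obtain ⟨y1, W', y2⟩ := y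
      obtain rfl : x1 = y1 := h1
      obtain rfl : W = W' := h2
      have : x2 = y2 := by
        refine Subtype.ext (LinearMap.ext fun w => Subtype.ext ?_)
        obtain ⟨w₀, hw₀⟩ := hsurj (x1, ⟨W, x2⟩) w
        rw [← hw₀]
        exact (hGW (x1, ⟨W, x2⟩) w₀).symm.trans
          ((LinearMap.congr_fun hG _).trans (hGW (x1, ⟨W, y2⟩) w₀))
      rw [this]
    · rintro ⟨⟨g, hg, hgh⟩, hgU⟩
      have hgUs := LinearMap.injective_iff_surjective.1 (injective_restrict hg hgU)
      have hgs := LinearMap.injective_iff_surjective.1 hg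
      have hW : IsCompl U (W₀.map g) := by
        refine ⟨Submodule.disjoint_def.2 ?_, codisjoint_iff.2 (eq_top_iff.2 ?_)⟩
        · rintro _ hx ⟨w, hw, rfl⟩
          obtain ⟨u, hu⟩ := hgUs ⟨_, hx⟩
          have huw : (u : V) = w := hg (congrArg Subtype.val hu)
          rw [Submodule.disjoint_def.1 h₀.disjoint w (huw ▸ u.2) hw, map_zero]
        · rintro v -
          obtain ⟨v, rfl⟩ := hgs v
          rw [← Submodule.projection_add_projection_eq_self h₀ v, map_add]
          exact Submodule.add_mem_sup (hgU (Submodule.projection_apply_mem _ _))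
            ⟨_, Submodule.projection_apply_mem h₀.symm _, rfl⟩
      have hWh : W₀.map g ∈ h.invtSubmodule := by
        rintro _ ⟨w, hw, rfl⟩
        exact ⟨h w, hW₀ hw, LinearMap.congr_fun hgh.eq w⟩
      -- The inverse construction takes `W = g(W₀)`. Its automorphism `k` sends a vector of `W` to
      -- its `W₀`-component along `U` and then applies `g`; this is injective because `W` meets `U`
      -- trivially.
      let p : End F V := g ∘ₗ W₀.projection U h₀.symm
      have hp : W₀.map g ∈ p.invtSubmodule :=
        fun w _ => ⟨_, Submodule.projection_apply_mem h₀.symm w, rfl⟩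
      have hpinj : Function.Injective (invtRestrict p hp) := by
        rw [injective_iff_map_eq_zero]
        intro w hw
        have h1 := (map_eq_zero_iff g hg).1 (congrArg Subtype.val hw)
        rw [Submodule.projection_apply_eq_zero_iff] at h1
        exact Subtype.ext (Submodule.disjoint_def.1 hW.disjoint _ h1 w.2)
      have hpc : Commute p h := by
        refine LinearMap.ext fun v => ?_
        change g (W₀.projectionOnto U h₀.symm (h v)) = h (g (W₀.projectionOnto U h₀.symm v))
        rw [projectionOnto_apply_of_mem_invtSubmodule h₀.symm hW₀ hU]
        exact LinearMap.congr_fun hgh.eq _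
      refine ⟨(⟨invtRestrict g hgU, injective_restrict hg hgU, commute_restrict hgh hgU hU⟩,
        ⟨⟨W₀.map g, hW, hWh⟩, ⟨invtRestrict p hp, hpinj, commute_restrict hpc hp hWh⟩⟩),
        Subtype.ext (Subtype.ext (LinearMap.ext fun v => ?_))⟩
      change g (U.projection W₀ h₀ v) + g (W₀.projection U h₀.symm
        ((W₀.map g).projection U hW.symm v)) = g v
      rw [Submodule.projection_eq_self_sub_projection hW v, map_sub,
        (Submodule.projection_apply_eq_zero_iff h₀.symm).2 (Submodule.projection_apply_mem hW v),
        sub_zero, ← map_add, Submodule.projection_add_projection_eq_self]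
  rw [← finsum_comp Φ hΦ, finsum_congr (fun x => by rw [hΦr x]), finsum_prod_of_finite,
    ← mul_finsum, ← natCast_card_sigma, finsum_mul]
  refine finsum_congr fun g => ?_
  refine (finsum_const_of_finite (ψ g.1)).trans ?_
  rw [nsmul_eq_mul, mul_comm]

/-- For a semisimple endomorphism, the Möbius recursion summed over its centralizer. -/
theorem finsum_centralizerMoebius_mul_card [Finite V] [Nontrivial V] {h : End F V}
    (hs : h.IsSemisimple) :
    ∑ᶠ U : {U : Submodule F V // U ∈ h.invtSubmodule},
      ∑ᶠ W : {W : Submodule F V // IsCompl U.1 W ∧ W ∈ h.invtSubmodule},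
        centralizerMoebius (invtRestrict h U.2) *
          (Nat.card (InjectiveCentralizer (invtRestrict h W.2.2)) : ℤ) = 0 := by
  have h0 : ∑ᶠ g : InjectiveCentralizer h,
      ∑ᶠ U : {U : Submodule F V // U ∈ g.1.invtSubmodule ∧ U ∈ h.invtSubmodule},
        invariantMoebius (invtRestrict g.1 U.2.1) (invtRestrict h U.2.2) = 0 := by
    have h1 : ∀ g : InjectiveCentralizer h,
        ∑ᶠ U : {U : Submodule F V // U ∈ g.1.invtSubmodule ∧ U ∈ h.invtSubmodule},
          invariantMoebius (invtRestrict g.1 U.2.1) (invtRestrict h U.2.2) = 0 :=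
      fun g => finsum_invariantMoebius_restrict g.1 h
    exact finsum_eq_zero_of_forall_eq_zero h1
  rw [← finsum_sigma_of_finite (fun x : Σ g : InjectiveCentralizer h,
      {U : Submodule F V // U ∈ g.1.invtSubmodule ∧ U ∈ h.invtSubmodule} =>
      invariantMoebius (invtRestrict x.1.1 x.2.2.1) (invtRestrict h x.2.2.2))] at h0
  rw [← h0]
  let e : (Σ U : {U : Submodule F V // U ∈ h.invtSubmodule},
        {g : InjectiveCentralizer h // U.1 ∈ g.1.invtSubmodule}) ≃
      (Σ g : InjectiveCentralizer h,
        {U : Submodule F V // U ∈ g.1.invtSubmodule ∧ U ∈ h.invtSubmodule}) :=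
    { toFun := fun x => ⟨x.2.1, x.1.1, x.2.2, x.1.2⟩
      invFun := fun x => ⟨⟨x.2.1, x.2.2.2⟩, x.1, x.2.2.1⟩
      left_inv := fun _ => rfl
      right_inv := fun _ => rfl }
  rw [← finsum_comp_equiv e, finsum_sigma_of_finite]
  refine finsum_congr fun U => ?_
  -- Semisimplicity is used only here, to supply an `h`-invariant reference complement.
  obtain ⟨W₀, hW₀, h₀⟩ := Module.End.isSemisimple_iff.1 hs U.1 U.2
  exact (finsum_injectiveCentralizer_restrict U.2 h₀ hW₀
    (fun g => invariantMoebius g (invtRestrict h U.2))).symm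

end Invariants

/-! ### Endomorphisms and direct sum decompositions. -/

section Decompositions

open Module Polynomial

variable {F V V' : Type*} [Field F] [AddCommGroup V] [Module F V] [AddCommGroup V'] [Module F V']

/-- Endomorphisms preserving two complementary subspaces are pairs of endomorphisms. -/
noncomputable def invtComplEquiv {U W : Submodule F V} (hUW : IsCompl U W) :
    {h : End F V // U ∈ h.invtSubmodule ∧ W ∈ h.invtSubmodule} ≃ End F U × End F W where
  toFun h := (invtRestrict h.1 h.2.1, invtRestrict h.1 h.2.2)
  invFun x := ⟨LinearMap.ofIsCompl hUW (U.subtype ∘ₗ x.1) (W.subtype ∘ₗ x.2), by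
      intro u hu
      rw [Submodule.mem_comap, LinearMap.ofIsCompl_apply_left hUW ⟨u, hu⟩]
      exact (x.1 _).2, by
      intro u hu
      rw [Submodule.mem_comap, LinearMap.ofIsCompl_apply_right hUW ⟨u, hu⟩]
      exact (x.2 _).2⟩
  left_inv h := Subtype.ext (LinearMap.ofIsCompl_eq hUW (fun _ => rfl) (fun _ => rfl))
  right_inv x := Prod.ext
    (LinearMap.ext fun u => Subtype.ext (LinearMap.ofIsCompl_apply_left hUW u))
    (LinearMap.ext fun u => Subtype.ext (LinearMap.ofIsCompl_apply_right hUW u))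

theorem eq_of_eqOn_isCompl {U W : Submodule F V} (hUW : IsCompl U W) {g h : V →ₗ[F] V'}
    (hU : ∀ u : U, g u = h u) (hW : ∀ w : W, g w = h w) : g = h := by
  refine LinearMap.ext fun v => ?_
  rw [← Submodule.projection_add_projection_eq_self hUW v, map_add, map_add]
  exact congrArg₂ _ (hU (U.projectionOnto W hUW v)) (hW (W.projectionOnto U hUW.symm v))

theorem coe_aeval_invtRestrict_apply (h : End F V) {U : Submodule F V} (hU : U ∈ h.invtSubmodule)
    (f : F[X]) (u : U) : (aeval (invtRestrict h hU) f u : V) = aeval h f u := by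
  induction f using Polynomial.induction_on' generalizing u with
  | add p q hp hq => simp [hp, hq]
  | monomial n a =>
    simp only [aeval_monomial]
    have : ∀ n (u : U), (((invtRestrict h hU) ^ n) u : V) = (h ^ n) u := by
      intro n
      induction n with
      | zero => intro u; rfl
      | succ n ih => intro u; rw [pow_succ, pow_succ, End.mul_apply, End.mul_apply, ih]; rfl
    change a • (((invtRestrict h hU) ^ n) u : V) = a • (h ^ n) u
    rw [this]

theorem aeval_invtRestrict_eq_zero_iff (h : End F V) {U : Submodule F V}
    (hU : U ∈ h.invtSubmodule) (f : F[X]) :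
    aeval (invtRestrict h hU) f = 0 ↔ U ≤ LinearMap.ker (aeval h f) := by
  constructor
  · intro h0 u hu
    rw [LinearMap.mem_ker, ← coe_aeval_invtRestrict_apply h hU f ⟨u, hu⟩, h0]
    rfl
  · intro h0
    refine LinearMap.ext fun u => Subtype.ext ?_
    rw [coe_aeval_invtRestrict_apply]
    exact h0 u.2

theorem aeval_eq_zero_iff_of_isCompl {h : End F V} {U W : Submodule F V} (hUW : IsCompl U W)
    (hU : U ∈ h.invtSubmodule) (hW : W ∈ h.invtSubmodule) (f : F[X]) :
    aeval h f = 0 ↔ aeval (invtRestrict h hU) f = 0 ∧ aeval (invtRestrict h hW) f = 0 := by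
  rw [aeval_invtRestrict_eq_zero_iff, aeval_invtRestrict_eq_zero_iff, ← sup_le_iff,
    hUW.sup_eq_top, top_le_iff, LinearMap.ker_eq_top]

theorem aeval_linearEquiv_conj (e : V ≃ₗ[F] V') (h : End F V) (f : F[X]) :
    aeval (e.conj h) f = e.conj (aeval h f) :=
  aeval_algHom_apply (e.conjAlgEquiv F) h f

/-- The number of automorphisms of `F ^ n`. -/
noncomputable def cardGL (F : Type*) [Field F] (n : ℕ) : ℕ :=
  Nat.card ((Fin n → F) ≃ₗ[F] (Fin n → F))

instance finite_linearEquiv [Finite V] : Finite (V ≃ₗ[F] V') := by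
  by_cases h : Nonempty (V ≃ₗ[F] V')
  · obtain ⟨e⟩ := h
    have : Finite V' := Finite.of_equiv V e.toEquiv
    exact Finite.of_injective _ DFunLike.coe_injective
  · have := not_nonempty_iff.1 h
    infer_instance

theorem cardGL_pos [Finite F] (n : ℕ) : 0 < cardGL F n :=
  have : Nonempty ((Fin n → F) ≃ₗ[F] (Fin n → F)) := ⟨LinearEquiv.refl _ _⟩
  Nat.card_pos

theorem card_linearEquiv_eq_cardGL [FiniteDimensional F V] [FiniteDimensional F V']
    {n : ℕ} (hV : finrank F V = n) (hV' : finrank F V' = n) :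
    Nat.card (V ≃ₗ[F] V') = cardGL F n := by
  have e : V ≃ₗ[F] (Fin n → F) := LinearEquiv.ofFinrankEq _ _ (by simp [hV])
  have e' : V' ≃ₗ[F] (Fin n → F) := LinearEquiv.ofFinrankEq _ _ (by simp [hV'])
  exact Nat.card_congr
    { toFun := fun g => (e.symm.trans g).trans e'
      invFun := fun g => (e.trans g).trans e'.symm
      left_inv := fun g => by ext; simp
      right_inv := fun g => by
        refine LinearEquiv.ext fun x => ?_
        simp }

/-- The number of decompositions of a vector space as a direct sum of subspaces of given
dimensions. -/
theorem card_isCompl_mul [Finite V] (k l : ℕ) (hkl : k + l = finrank F V) :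
    Nat.card {p : {p : Submodule F V × Submodule F V // IsCompl p.1 p.2} //
      (finrank F p.1.1, finrank F p.1.2) = (k, l)} * (cardGL F k * cardGL F l) =
    cardGL F (finrank F V) := by
  have : FiniteDimensional F V := Module.Finite.of_finite
  let D := {p : {p : Submodule F V × Submodule F V // IsCompl p.1 p.2} //
      (finrank F p.1.1, finrank F p.1.2) = (k, l)}
  let E (p : D) := ((Fin k → F) ≃ₗ[F] p.1.1.1) × ((Fin l → F) ≃ₗ[F] p.1.1.2)
  have hF : Finite D := inferInstance
  have hcard : Nat.card (Σ p : D, E p) = Nat.card D * (cardGL F k * cardGL F l) := by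
    have := Fintype.ofFinite D
    have hfin : ∀ p, Finite (E p) := fun p => by
      have : Finite ((Fin k → F) ≃ₗ[F] p.1.1.1) :=
        Finite.of_injective (fun e => e.symm) (fun a b h => by simpa using congrArg (·.symm) h)
      have : Finite ((Fin l → F) ≃ₗ[F] p.1.1.2) :=
        Finite.of_injective (fun e => e.symm) (fun a b h => by simpa using congrArg (·.symm) h)
      exact inferInstanceAs (Finite (_ × _))
    rw [Nat.card_sigma, Finset.sum_congr rfl (fun p _ => (_ : Nat.card (E p) =
      cardGL F k * cardGL F l))]
    · simp
    · intro p _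
      rw [Nat.card_prod, card_linearEquiv_eq_cardGL (n := k) (by simp)
        (congrArg Prod.fst p.2), card_linearEquiv_eq_cardGL (n := l) (by simp)
        (congrArg Prod.snd p.2)]
  rw [← hcard, ← card_linearEquiv_eq_cardGL (V := (Fin k → F) × (Fin l → F)) (V' := V)
    (by simp [hkl]) rfl]
  -- Double counting: an isomorphism `F ^ k × F ^ l ≃ V` is a decomposition of `V`, given by the
  -- images of the two factors, together with a parametrisation of each summand.
  let Φ : (Σ p : D, E p) → (((Fin k → F) × (Fin l → F)) ≃ₗ[F] V) := fun x =>
    (x.2.1.prodCongr x.2.2).trans (Submodule.prodEquivOfIsCompl _ _ x.1.1.2)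
  have hl : ∀ x a, Φ x (a, 0) = x.2.1 a := fun x a => by simp [Φ]
  have hr : ∀ x b, Φ x (0, b) = x.2.2 b := fun x a => by simp [Φ]
  refine Nat.card_congr (Equiv.ofBijective Φ ⟨?_, ?_⟩)
  · intro x y hxy
    have h1 : ∀ x y, Φ x = Φ y → x.1.1.1.1 ≤ y.1.1.1.1 := by
      intro x y hxy u hu
      have := hl x (x.2.1.symm ⟨u, hu⟩)
      rw [hxy, hl, LinearEquiv.apply_symm_apply] at this
      change _ = u at this
      rw [← this]
      exact Subtype.coe_prop _
    have h2 : ∀ x y, Φ x = Φ y → x.1.1.1.2 ≤ y.1.1.1.2 := by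
      intro x y hxy u hu
      have := hr x (x.2.2.symm ⟨u, hu⟩)
      rw [hxy, hr, LinearEquiv.apply_symm_apply] at this
      change _ = u at this
      rw [← this]
      exact Subtype.coe_prop _
    have h : x.1 = y.1 := Subtype.ext (Subtype.ext (Prod.ext
      (le_antisymm (h1 x y hxy) (h1 y x hxy.symm)) (le_antisymm (h2 x y hxy) (h2 y x hxy.symm))))
    obtain ⟨p, a, b⟩ := x
    obtain ⟨q, c, d⟩ := y
    obtain rfl : p = q := h
    have hac : a = c := LinearEquiv.ext fun z => Subtype.ext
      ((hl ⟨p, a, b⟩ z).symm.trans ((LinearEquiv.congr_fun hxy _).trans (hl ⟨p, c, d⟩ z)))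
    have hbd : b = d := LinearEquiv.ext fun z => Subtype.ext
      ((hr ⟨p, a, b⟩ z).symm.trans ((LinearEquiv.congr_fun hxy _).trans (hr ⟨p, c, d⟩ z)))
    rw [hac, hbd]
  · intro e
    let i : (Fin k → F) →ₗ[F] V := e.toLinearMap ∘ₗ LinearMap.inl F _ _
    let j : (Fin l → F) →ₗ[F] V := e.toLinearMap ∘ₗ LinearMap.inr F _ _
    have hi : Function.Injective i := e.injective.comp LinearMap.inl_injective
    have hj : Function.Injective j := e.injective.comp LinearMap.inr_injective
    have hc : IsCompl (LinearMap.range i) (LinearMap.range j) := by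
      have := (LinearMap.isCompl_range_inl_inr (R := F) (M := Fin k → F) (M₂ := Fin l → F)).map
        (Submodule.orderIsoMapComap e)
      simpa [i, j, LinearMap.range_comp] using this
    refine ⟨⟨⟨⟨(LinearMap.range i, LinearMap.range j), hc⟩, ?_⟩,
      LinearEquiv.ofInjective i hi, LinearEquiv.ofInjective j hj⟩, ?_⟩
    · simp [LinearMap.finrank_range_of_inj hi, LinearMap.finrank_range_of_inj hj]
    · refine LinearEquiv.ext fun x => ?_
      simp [Φ, i, j, ← map_add]

/-- Sums over direct sum decompositions of functions of the dimensions are convolutions. -/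
theorem finsum_isCompl_eq_sum_antidiagonal [Finite F] [Finite V] (a b : ℕ → ℚ) :
    (∑ᶠ p : {p : Submodule F V × Submodule F V // IsCompl p.1 p.2},
      a (finrank F p.1.1) * b (finrank F p.1.2)) / cardGL F (finrank F V) =
    ∑ x ∈ Finset.HasAntidiagonal.antidiagonal (finrank F V),
      (a x.1 / cardGL F x.1) * (b x.2 / cardGL F x.2) := by
  classical
  have : FiniteDimensional F V := Module.Finite.of_finite
  have := Fintype.ofFinite {p : Submodule F V × Submodule F V // IsCompl p.1 p.2}
  rw [finsum_eq_sum_of_fintype, ← Finset.sum_fiberwise_of_maps_to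
    (t := Finset.HasAntidiagonal.antidiagonal (finrank F V)) (g := fun p => (finrank F p.1.1, finrank F p.1.2))
    (fun p _ => by simpa using Submodule.finrank_add_eq_of_isCompl p.2), Finset.sum_div]
  refine Finset.sum_congr rfl fun x hx => ?_
  obtain ⟨k, l⟩ := x
  rw [Finset.sum_congr rfl (g := fun _ => a k * b l) (fun p hp => by
    simp only [Finset.mem_filter, Prod.mk.injEq] at hp
    rw [hp.2.1, hp.2.2]), Finset.sum_const, nsmul_eq_mul]
  have h := card_isCompl_mul (F := F) (V := V) k l (Finset.HasAntidiagonal.mem_antidiagonal.1 hx)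
  rw [Nat.card_eq_fintype_card, Fintype.card_subtype] at h
  rw [← h]
  have h1 := (cardGL_pos (F := F) k).ne'
  have h2 := (cardGL_pos (F := F) l).ne'
  have h3 := (cardGL_pos (F := F) (finrank F V)).ne'
  rw [← h] at h3
  push_cast
  have h3' := left_ne_zero_of_mul h3
  field_simp

end Decompositions

/-! ### Generating series and their convolution identity. -/

section GeneratingSeries

open Module Polynomial

variable {F V V' : Type*} [Field F] [AddCommGroup V] [Module F V] [AddCommGroup V'] [Module F V']

theorem injective_and_commute_conj_iff (e : V ≃ₗ[F] V') (g h : End F V) :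
    (Function.Injective g ∧ Commute g h) ↔
      (Function.Injective (e.conj g) ∧ Commute (e.conj g) (e.conj h)) := by
  refine and_congr ?_ ?_
  · change _ ↔ Function.Injective (e ∘ g ∘ e.symm)
    rw [e.injective.of_comp_iff, Function.Injective.of_comp_iff' _ e.symm.bijective]
  · have h1 : e.conj (g * h) = e.conj g * e.conj h := map_mul (e.conjAlgEquiv F) g h
    have h2 : e.conj (h * g) = e.conj h * e.conj g := map_mul (e.conjAlgEquiv F) h g
    rw [Commute, SemiconjBy, Commute, SemiconjBy, ← h1, ← h2, e.conj.injective.eq_iff]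

theorem card_injectiveCentralizer_congr (e : V ≃ₗ[F] V') (h : End F V) :
    Nat.card (InjectiveCentralizer h) = Nat.card (InjectiveCentralizer (e.conj h)) :=
  Nat.card_congr (e.conj.toEquiv.subtypeEquiv fun g => injective_and_commute_conj_iff e g h)

theorem centralizerMoebius_congr (e : V ≃ₗ[F] V') (h : End F V) :
    centralizerMoebius h = centralizerMoebius (e.conj h) := by
  unfold centralizerMoebius
  rw [← finsum_comp_equiv (e.conj.toEquiv.subtypeEquiv
    fun g => injective_and_commute_conj_iff e g h)]
  exact finsum_congr fun g => invariantMoebius_congr e (fun v => by simp) (fun v => by simp)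

open Classical in
/-- The sum of `centralizerMoebius` over the endomorphisms annihilated by `f`. -/
noncomputable def totalMoebius (f : F[X]) (V : Type*) [AddCommGroup V] [Module F V] : ℤ :=
  ∑ᶠ h : End F V, if aeval h f = 0 then centralizerMoebius h else 0

open Classical in
/-- The number of commuting pairs of an automorphism and an endomorphism annihilated by `f`. -/
noncomputable def totalCentralizer (f : F[X]) (V : Type*) [AddCommGroup V] [Module F V] : ℤ :=
  ∑ᶠ h : End F V, if aeval h f = 0 then (Nat.card (InjectiveCentralizer h) : ℤ) else 0

theorem aeval_linearEquiv_conj_eq_zero_iff (e : V ≃ₗ[F] V') (h : End F V) (f : F[X]) :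
    aeval (e.conj h) f = 0 ↔ aeval h f = 0 := by
  rw [aeval_linearEquiv_conj, LinearEquiv.map_eq_zero_iff]

open Classical in
theorem totalMoebius_congr (e : V ≃ₗ[F] V') (f : F[X]) : totalMoebius f V = totalMoebius f V' := by
  unfold totalMoebius
  rw [← finsum_comp_equiv e.conj.toEquiv]
  refine finsum_congr fun h => ?_
  change _ = if aeval (e.conj h) f = 0 then centralizerMoebius (e.conj h) else 0
  simp only [aeval_linearEquiv_conj_eq_zero_iff, ← centralizerMoebius_congr]

open Classical in
theorem totalCentralizer_congr (e : V ≃ₗ[F] V') (f : F[X]) :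
    totalCentralizer f V = totalCentralizer f V' := by
  unfold totalCentralizer
  rw [← finsum_comp_equiv e.conj.toEquiv]
  refine finsum_congr fun h => ?_
  change _ = if aeval (e.conj h) f = 0 then (Nat.card (InjectiveCentralizer (e.conj h)) : ℤ) else 0
  simp only [aeval_linearEquiv_conj_eq_zero_iff, ← card_injectiveCentralizer_congr]

/-- The generating series of `totalMoebius`, normalised by the order of the linear group. -/
noncomputable def moebiusSeries (f : F[X]) : ℚ⟦X⟧ :=
  PowerSeries.mk fun n => (totalMoebius f (Fin n → F) : ℚ) / cardGL F n

/-- The generating series of `totalCentralizer`, normalised by the order of the linear group. -/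
noncomputable def centralizerSeries (f : F[X]) : ℚ⟦X⟧ :=
  PowerSeries.mk fun n => (totalCentralizer f (Fin n → F) : ℚ) / cardGL F n

theorem totalMoebius_eq_finrank [FiniteDimensional F V] (f : F[X]) :
    totalMoebius f V = totalMoebius f (Fin (finrank F V) → F) :=
  totalMoebius_congr (LinearEquiv.ofFinrankEq _ _ (by simp)) f

theorem totalCentralizer_eq_finrank [FiniteDimensional F V] (f : F[X]) :
    totalCentralizer f V = totalCentralizer f (Fin (finrank F V) → F) :=
  totalCentralizer_congr (LinearEquiv.ofFinrankEq _ _ (by simp)) f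

/-- The index type of triples of an endomorphism and two complementary invariant subspaces. -/
abbrev InvariantDecomposition (h : End F V) : Type _ :=
  Σ U : {U : Submodule F V // U ∈ h.invtSubmodule},
    {W : Submodule F V // IsCompl U.1 W ∧ W ∈ h.invtSubmodule}

/-- Summing over endomorphisms of the two summands of a decomposition amounts to summing over
endomorphisms together with an invariant decomposition. -/
theorem finsum_isCompl_finsum_end [Finite V]
    (φ : ∀ U W : Submodule F V, End F U → End F W → ℤ) :
    ∑ᶠ p : {p : Submodule F V × Submodule F V // IsCompl p.1 p.2},
      ∑ᶠ h₁ : End F p.1.1, ∑ᶠ h₂ : End F p.1.2, φ _ _ h₁ h₂ =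
    ∑ᶠ h : End F V, ∑ᶠ D : InvariantDecomposition h,
      φ _ _ (invtRestrict h D.1.2) (invtRestrict h D.2.2.2) := by
  have h1 : ∀ p : {p : Submodule F V × Submodule F V // IsCompl p.1 p.2},
      ∑ᶠ h₁ : End F p.1.1, ∑ᶠ h₂ : End F p.1.2, φ _ _ h₁ h₂ =
      ∑ᶠ h : {h : End F V // p.1.1 ∈ h.invtSubmodule ∧ p.1.2 ∈ h.invtSubmodule},
        φ _ _ (invtRestrict h.1 h.2.1) (invtRestrict h.1 h.2.2) := by
    intro p
    rw [← finsum_prod_of_finite (fun x : End F p.1.1 × End F p.1.2 => φ _ _ x.1 x.2),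
      ← finsum_comp_equiv (invtComplEquiv p.2)]
    rfl
  rw [finsum_congr h1, ← finsum_sigma_of_finite
    (fun x : Σ p : {p : Submodule F V × Submodule F V // IsCompl p.1 p.2},
      {h : End F V // p.1.1 ∈ h.invtSubmodule ∧ p.1.2 ∈ h.invtSubmodule} =>
      φ _ _ (invtRestrict x.2.1 x.2.2.1) (invtRestrict x.2.1 x.2.2.2)),
    ← finsum_sigma_of_finite (fun x : Σ h : End F V, InvariantDecomposition h =>
      φ _ _ (invtRestrict x.1 x.2.1.2) (invtRestrict x.1 x.2.2.2.2))]
  let e : (Σ h : End F V, InvariantDecomposition h) ≃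
      (Σ p : {p : Submodule F V × Submodule F V // IsCompl p.1 p.2},
        {h : End F V // p.1.1 ∈ h.invtSubmodule ∧ p.1.2 ∈ h.invtSubmodule}) :=
    { toFun := fun x => ⟨⟨(x.2.1.1, x.2.2.1), x.2.2.2.1⟩, x.1, x.2.1.2, x.2.2.2.2⟩
      invFun := fun x => ⟨x.2.1, ⟨x.1.1.1, x.2.2.1⟩, x.1.1.2, x.1.2, x.2.2.2⟩
      left_inv := fun _ => rfl
      right_inv := fun _ => rfl }
  rw [← finsum_comp_equiv e]
  rfl

/-- Exchanging the sums groups the terms by an endomorphism `h` of all of `V`. If `f` annihilates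
`h`, squarefreeness makes `h` semisimple and the centralizer recursion gives zero; otherwise `f`
fails to annihilate `h` on one of the two summands and each term is zero. -/
theorem finsum_totalMoebius_mul_totalCentralizer [Finite V] [Nontrivial V] {f : F[X]}
    (hf : Squarefree f) :
    ∑ᶠ p : {p : Submodule F V × Submodule F V // IsCompl p.1 p.2},
      totalMoebius f p.1.1 * totalCentralizer f p.1.2 = 0 := by
  classical
  have h1 : ∀ p : {p : Submodule F V × Submodule F V // IsCompl p.1 p.2},
      totalMoebius f p.1.1 * totalCentralizer f p.1.2 = ∑ᶠ h₁ : End F p.1.1, ∑ᶠ h₂ : End F p.1.2,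
        (if Polynomial.aeval h₁ f = 0 then centralizerMoebius h₁ else 0) *
          if Polynomial.aeval h₂ f = 0 then (Nat.card (InjectiveCentralizer h₂) : ℤ) else 0 := by
    intro p
    unfold totalMoebius totalCentralizer
    rw [finsum_mul]
    exact finsum_congr fun h₁ => mul_finsum _ _
  rw [finsum_congr h1, finsum_isCompl_finsum_end (fun U W (h₁ : End F U) (h₂ : End F W) =>
    (if Polynomial.aeval h₁ f = 0 then centralizerMoebius h₁ else 0) *
      if Polynomial.aeval h₂ f = 0 then (Nat.card (InjectiveCentralizer h₂) : ℤ) else 0)]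
  refine finsum_eq_zero_of_forall_eq_zero fun h => ?_
  by_cases hh : aeval h f = 0
  · rw [finsum_sigma_of_finite, ← finsum_centralizerMoebius_mul_card
      (Module.End.isSemisimple_of_squarefree_aeval_eq_zero hf hh)]
    refine finsum_congr fun U => finsum_congr fun W => ?_
    have := (aeval_eq_zero_iff_of_isCompl W.2.1 U.2 W.2.2 f).1 hh
    rw [if_pos this.1, if_pos this.2]
  · refine finsum_eq_zero_of_forall_eq_zero fun D => ?_
    rw [aeval_eq_zero_iff_of_isCompl D.2.2.1 D.1.2 D.2.2.2, not_and_or] at hh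
    rcases hh with hh | hh
    · rw [if_neg hh, zero_mul]
    · rw [if_neg hh, mul_zero]

/-- The product formula for the coefficients of two series over the decompositions of a space. -/
theorem finsum_isCompl_div_cardGL [Finite F] [Finite V]
    (a b : Submodule F V → ℤ) (α β : ℕ → ℤ) (ha : ∀ U, a U = α (finrank F U))
    (hb : ∀ U, b U = β (finrank F U)) :
    ((∑ᶠ p : {p : Submodule F V × Submodule F V // IsCompl p.1 p.2}, a p.1.1 * b p.1.2 : ℤ) : ℚ) /
      cardGL F (finrank F V) =
    coeff (finrank F V) ((PowerSeries.mk fun n => (α n : ℚ) / cardGL F n) *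
      (PowerSeries.mk fun n => (β n : ℚ) / cardGL F n)) := by
  have := Fintype.ofFinite {p : Submodule F V × Submodule F V // IsCompl p.1 p.2}
  rw [PowerSeries.coeff_mul]
  simp only [PowerSeries.coeff_mk]
  rw [← finsum_isCompl_eq_sum_antidiagonal (fun n => (α n : ℚ)) (fun n => (β n : ℚ)), finsum_eq_sum_of_fintype, finsum_eq_sum_of_fintype]
  simp [ha, hb]

theorem card_injectiveCentralizer_of_subsingleton [Subsingleton V] (h : End F V) :
    Nat.card (InjectiveCentralizer h) = 1 := by
  have : Subsingleton (End F V) := ⟨fun a b => LinearMap.ext fun v => Subsingleton.elim _ _⟩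
  have : Nonempty (InjectiveCentralizer h) :=
    ⟨⟨0, Function.injective_of_subsingleton _, Commute.zero_left _⟩⟩
  exact Nat.card_unique

theorem centralizerMoebius_of_subsingleton [Subsingleton V] (h : End F V) :
    centralizerMoebius h = 1 := by
  have : Finite V := Finite.of_subsingleton
  unfold centralizerMoebius invariantMoebius
  have hV : Subsingleton V := inferInstance
  simp only [if_pos hV]
  rw [finsum_const_of_finite, card_injectiveCentralizer_of_subsingleton, one_smul]

theorem totalMoebius_of_subsingleton [Subsingleton V] (f : F[X]) : totalMoebius f V = 1 := by
  have : Subsingleton (End F V) := ⟨fun a b => LinearMap.ext fun v => Subsingleton.elim _ _⟩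
  unfold totalMoebius
  have h0 : ∀ h : End F V, Polynomial.aeval h f = 0 := fun h => Subsingleton.elim _ _
  simp only [h0, if_true, centralizerMoebius_of_subsingleton]
  rw [finsum_const_of_finite, Nat.card_unique, one_smul]

theorem totalCentralizer_of_subsingleton [Subsingleton V] (f : F[X]) :
    totalCentralizer f V = 1 := by
  have : Subsingleton (End F V) := ⟨fun a b => LinearMap.ext fun v => Subsingleton.elim _ _⟩
  unfold totalCentralizer
  have h0 : ∀ h : End F V, Polynomial.aeval h f = 0 := fun h => Subsingleton.elim _ _
  simp only [h0, if_true, card_injectiveCentralizer_of_subsingleton]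
  rw [finsum_const_of_finite, Nat.card_unique, one_smul, Nat.cast_one]

theorem cardGL_zero (F : Type*) [Field F] : cardGL F 0 = 1 := Nat.card_unique

/-- The decomposition sums are the coefficients of the product in positive degree, where they
vanish. In degree `0` both series have coefficient `1`. -/
theorem moebiusSeries_mul_centralizerSeries [Finite F] {f : F[X]} (hf : Squarefree f) :
    moebiusSeries f * centralizerSeries f = 1 := by
  ext n
  rcases Nat.eq_zero_or_pos n with rfl | hn
  · simp [PowerSeries.coeff_mul, moebiusSeries, centralizerSeries, cardGL_zero,
      totalMoebius_of_subsingleton, totalCentralizer_of_subsingleton]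
  · have : NeZero n := ⟨hn.ne'⟩
    have h := finsum_isCompl_div_cardGL (V := Fin n → F) (fun U => totalMoebius f U)
      (fun U => totalCentralizer f U) (fun n => totalMoebius f (Fin n → F))
      (fun n => totalCentralizer f (Fin n → F)) (fun U => totalMoebius_eq_finrank f)
      (fun U => totalCentralizer_eq_finrank f)
    rw [finsum_totalMoebius_mul_totalCentralizer hf] at h
    simp only [Int.cast_zero, zero_div, finrank_fin_fun] at h
    rw [PowerSeries.coeff_one, if_neg hn.ne']
    exact h.symm

end GeneratingSeries

/-! ### Evaluation of the series counting commuting pairs. -/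

section CentralizerSeries

open Module

variable {F V V' : Type*} [Field F] [AddCommGroup V] [Module F V] [AddCommGroup V'] [Module F V']

/-- When the whole centralizer preserves both summands, its elements are block diagonal. -/
theorem card_injectiveCentralizer_eq_mul [Finite V] {h : End F V} {U W : Submodule F V}
    (hUW : IsCompl U W) (hU : U ∈ h.invtSubmodule) (hW : W ∈ h.invtSubmodule)
    (hinv : ∀ g : End F V, Commute g h → U ∈ g.invtSubmodule ∧ W ∈ g.invtSubmodule) :
    Nat.card (InjectiveCentralizer h) = Nat.card (InjectiveCentralizer (invtRestrict h hU)) *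
      Nat.card (InjectiveCentralizer (invtRestrict h hW)) := by
  rw [← Nat.card_prod]
  refine Nat.card_congr (Equiv.ofBijective (fun g =>
    (⟨invtRestrict g.1 (hinv g.1 g.2.2).1, injective_restrict g.2.1 _, commute_restrict g.2.2 _ hU⟩,
      ⟨invtRestrict g.1 (hinv g.1 g.2.2).2, injective_restrict g.2.1 _,
        commute_restrict g.2.2 _ hW⟩)) ⟨?_, ?_⟩)
  · intro g g' hgg
    simp only [Prod.mk.injEq, Subtype.mk.injEq] at hgg
    exact Subtype.ext (eq_of_eqOn_isCompl hUW
      (fun u => congrArg Subtype.val (LinearMap.congr_fun hgg.1 u))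
      (fun u => congrArg Subtype.val (LinearMap.congr_fun hgg.2 u)))
  · rintro ⟨⟨g₁, hg₁, hc₁⟩, ⟨g₂, hg₂, hc₂⟩⟩
    obtain ⟨⟨g, hgU, hgW⟩, hg⟩ := (invtComplEquiv hUW).surjective (g₁, g₂)
    obtain rfl : invtRestrict g hgU = g₁ := congrArg Prod.fst hg
    obtain rfl : invtRestrict g hgW = g₂ := congrArg Prod.snd hg
    have hinj : Function.Injective g := by
      rw [injective_iff_map_eq_zero]
      intro v hv
      have hv' := hv
      rw [← Submodule.projection_add_projection_eq_self hUW v, map_add] at hv'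
      have h1 := Submodule.disjoint_def.1 hUW.disjoint _
        (hgU (Submodule.projection_apply_mem hUW v)) (by
          rw [eq_neg_of_add_eq_zero_left hv']
          exact neg_mem (hgW (Submodule.projection_apply_mem hUW.symm v)))
      rw [h1, zero_add] at hv'
      rw [← Submodule.projection_add_projection_eq_self hUW v]
      have h3 : U.projectionOnto W hUW v = 0 :=
        (map_eq_zero_iff _ hg₁).1 (Subtype.ext h1)
      have h4 : W.projectionOnto U hUW.symm v = 0 :=
        (map_eq_zero_iff _ hg₂).1 (Subtype.ext hv')
      rw [Submodule.projection_apply, Submodule.projection_apply, h3, h4]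
      simp
    have hcomm : Commute g h := eq_of_eqOn_isCompl hUW
      (fun u => congrArg Subtype.val (LinearMap.congr_fun hc₁.eq u))
      (fun u => congrArg Subtype.val (LinearMap.congr_fun hc₂.eq u))
    exact ⟨⟨g, hinj, hcomm⟩, rfl⟩

theorem ker_aeval_mem_invtSubmodule {g h : End F V} (hgh : Commute g h) (f : Polynomial F) :
    LinearMap.ker (Polynomial.aeval h f) ∈ g.invtSubmodule := by
  have hc : Commute g (Polynomial.aeval h f) := by
    induction f using Polynomial.induction_on' with
    | add p q hp hq => rw [map_add]; exact hp.add_right hq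
    | monomial n a =>
      rw [Polynomial.aeval_monomial]
      exact (show Commute g _ from (Algebra.commutes a g).symm).mul_right (hgh.pow_right n)
  intro v hv
  rw [LinearMap.mem_ker] at hv
  rw [Submodule.mem_comap, LinearMap.mem_ker]
  have := LinearMap.congr_fun hc.eq v
  rw [End.mul_apply, End.mul_apply, hv, map_zero] at this
  exact this.symm

theorem eq_of_le_of_isCompl {U W K L : Submodule F V} (hUW : IsCompl U W) (hKL : Disjoint K L)
    (hU : U ≤ K) (hW : W ≤ L) : U = K := by
  refine le_antisymm hU fun x hx => ?_
  have h := Submodule.projection_add_projection_eq_self hUW x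
  have hw : W.projection U hUW.symm x ∈ K := by
    rw [← eq_sub_iff_add_eq'] at h
    rw [h]
    exact sub_mem hx (hU (Submodule.projection_apply_mem hUW x))
  rw [Submodule.disjoint_def.1 hKL _ hw (hW (Submodule.projection_apply_mem _ _)), add_zero] at h
  rw [← h]
  exact Submodule.projection_apply_mem hUW x

/-- Primary decomposition: an `h` annihilated by `f₁ * f₂` admits exactly one decomposition with
`fᵢ` annihilating the `i`-th summand, namely the kernels of `f₁(h)` and `f₂(h)`. Everything
commuting with `h` preserves these kernels, so the centralizer splits as well. -/
theorem finsum_totalCentralizer_mul_totalCentralizer [Finite V] {f₁ f₂ : Polynomial F}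
    (hf : IsCoprime f₁ f₂) :
    ∑ᶠ p : {p : Submodule F V × Submodule F V // IsCompl p.1 p.2},
      totalCentralizer f₁ p.1.1 * totalCentralizer f₂ p.1.2 = totalCentralizer (f₁ * f₂) V := by
  classical
  have h1 : ∀ p : {p : Submodule F V × Submodule F V // IsCompl p.1 p.2},
      totalCentralizer f₁ p.1.1 * totalCentralizer f₂ p.1.2 =
      ∑ᶠ h₁ : End F p.1.1, ∑ᶠ h₂ : End F p.1.2,
        (if Polynomial.aeval h₁ f₁ = 0 then (Nat.card (InjectiveCentralizer h₁) : ℤ) else 0) *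
          if Polynomial.aeval h₂ f₂ = 0 then (Nat.card (InjectiveCentralizer h₂) : ℤ) else 0 := by
    intro p
    unfold totalCentralizer
    rw [finsum_mul]
    exact finsum_congr fun h₁ => mul_finsum _ _
  rw [finsum_congr h1, finsum_isCompl_finsum_end (fun U W (h₁ : End F U) (h₂ : End F W) =>
    (if Polynomial.aeval h₁ f₁ = 0 then (Nat.card (InjectiveCentralizer h₁) : ℤ) else 0) *
      if Polynomial.aeval h₂ f₂ = 0 then (Nat.card (InjectiveCentralizer h₂) : ℤ) else 0)]
  refine finsum_congr fun h => ?_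
  have hdisj := Polynomial.disjoint_ker_aeval_of_isCoprime h hf
  have hsup := Polynomial.sup_ker_aeval_eq_ker_aeval_mul_of_coprime h hf
  by_cases hh : Polynomial.aeval h (f₁ * f₂) = 0
  · rw [hh, LinearMap.ker_zero] at hsup
    have hK : IsCompl (LinearMap.ker (Polynomial.aeval h f₁))
        (LinearMap.ker (Polynomial.aeval h f₂)) := ⟨hdisj, codisjoint_iff.2 hsup⟩
    have hinv : ∀ (g : End F V) f, Commute g h →
      LinearMap.ker (Polynomial.aeval h f) ∈ g.invtSubmodule :=
        fun g f hgh => ker_aeval_mem_invtSubmodule hgh f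
    rw [finsum_eq_single _ (⟨⟨_, hinv h f₁ (Commute.refl h)⟩, ⟨_, hK, hinv h f₂ (Commute.refl h)⟩⟩ :
      InvariantDecomposition h), if_pos hh,
      if_pos ((aeval_invtRestrict_eq_zero_iff _ _ _).2 le_rfl),
      if_pos ((aeval_invtRestrict_eq_zero_iff _ _ _).2 le_rfl),
      card_injectiveCentralizer_eq_mul hK (hinv h f₁ (Commute.refl h)) (hinv h f₂ (Commute.refl h))
        (fun g hg => ⟨hinv g f₁ hg, hinv g f₂ hg⟩), Nat.cast_mul]
    rintro ⟨⟨U, hU⟩, ⟨W, hUW, hW⟩⟩ hne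
    by_contra hne'
    refine hne ?_
    have h1 := left_ne_zero_of_mul hne'
    have h2 := right_ne_zero_of_mul hne'
    simp only [ne_eq, ite_eq_right_iff, Classical.not_imp, aeval_invtRestrict_eq_zero_iff] at h1 h2
    obtain rfl := eq_of_le_of_isCompl hUW hdisj h1.1 h2.1
    obtain rfl := eq_of_le_of_isCompl hUW.symm hdisj.symm h2.1 le_rfl
    rfl
  · rw [if_neg hh]
    refine finsum_eq_zero_of_forall_eq_zero fun D => ?_
    by_contra hne'
    have h1 := left_ne_zero_of_mul hne'
    have h2 := right_ne_zero_of_mul hne'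
    simp only [ne_eq, ite_eq_right_iff, Classical.not_imp, aeval_invtRestrict_eq_zero_iff] at h1 h2
    refine hh ?_
    rw [← LinearMap.ker_eq_top, ← hsup, eq_top_iff, ← D.2.2.1.sup_eq_top]
    exact sup_le_sup h1.1 h2.1

theorem centralizerSeries_mul [Finite F] {f₁ f₂ : Polynomial F} (hf : IsCoprime f₁ f₂) :
    centralizerSeries (f₁ * f₂) = centralizerSeries f₁ * centralizerSeries f₂ := by
  ext n
  have h := finsum_isCompl_div_cardGL (V := Fin n → F) (fun U => totalCentralizer f₁ U)
    (fun U => totalCentralizer f₂ U) (fun n => totalCentralizer f₁ (Fin n → F))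
    (fun n => totalCentralizer f₂ (Fin n → F)) (fun U => totalCentralizer_eq_finrank f₁)
    (fun U => totalCentralizer_eq_finrank f₂)
  rw [finsum_totalCentralizer_mul_totalCentralizer hf] at h
  simp only [finrank_fin_fun] at h
  rw [centralizerSeries, centralizerSeries, centralizerSeries, ← h, coeff_mk]

theorem centralizerSeries_of_isUnit [Finite F] {f : Polynomial F} (hf : IsUnit f) :
    centralizerSeries f = 1 := by
  ext n
  rcases Nat.eq_zero_or_pos n with rfl | hn
  · simp [centralizerSeries, cardGL_zero, totalCentralizer_of_subsingleton]
  · have : NeZero n := ⟨hn.ne'⟩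
    have : totalCentralizer f (Fin n → F) = 0 := by
      classical
      refine finsum_eq_zero_of_forall_eq_zero fun h => if_neg fun h0 => ?_
      have := hf.map (Polynomial.aeval h)
      rw [h0, isUnit_zero_iff] at this
      exact zero_ne_one this
    rw [centralizerSeries, coeff_mk, this, PowerSeries.coeff_one, if_neg hn.ne']
    simp

/-- The module structure over `F[X]/(P)` given by an endomorphism annihilated by `P`. -/
noncomputable abbrev adjoinRootModule {P : Polynomial F} {h : End F V}
    (hP : Polynomial.aeval h P = 0) : Module (AdjoinRoot P) V :=
  Module.compHom V (Ideal.Quotient.lift (Ideal.span {P}) (Polynomial.aeval h).toRingHom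
    (fun a ha => by
      obtain ⟨b, rfl⟩ := Ideal.mem_span_singleton'.1 ha
      change Polynomial.aeval h (b * P) = 0
      rw [map_mul, hP, mul_zero]) : AdjoinRoot P →+* End F V)

/-- An endomorphism annihilated by `P` is a vector space structure over the field `F[X]/(P)`, with
the endomorphism acting as the root. Such structures are classified by dimension. -/
theorem natDegree_dvd_finrank_and_exists_linearEquiv [FiniteDimensional F V]
    [FiniteDimensional F V'] {P : Polynomial F} (hirr : Irreducible P) {h : End F V}
    {h' : End F V'} (hP : Polynomial.aeval h P = 0) (hP' : Polynomial.aeval h' P = 0)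
    (hfin : finrank F V = finrank F V') :
    P.natDegree ∣ finrank F V ∧ ∃ e : V ≃ₗ[F] V', e.conj h = h' := by
  have : Fact (Irreducible P) := ⟨hirr⟩
  let : Module (AdjoinRoot P) V := adjoinRootModule hP
  let : Module (AdjoinRoot P) V' := adjoinRootModule hP'
  have hs : ∀ (p : Polynomial F) (v : V), AdjoinRoot.mk P p • v = Polynomial.aeval h p v :=
    fun _ _ => rfl
  have hs' : ∀ (p : Polynomial F) (v : V'), AdjoinRoot.mk P p • v = Polynomial.aeval h' p v :=
    fun _ _ => rfl
  have : IsScalarTower F (AdjoinRoot P) V := ⟨fun a x v => by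
    obtain ⟨p, rfl⟩ := AdjoinRoot.mk_surjective x
    rw [AdjoinRoot.smul_mk, hs, hs, map_smul]; rfl⟩
  have : IsScalarTower F (AdjoinRoot P) V' := ⟨fun a x v => by
    obtain ⟨p, rfl⟩ := AdjoinRoot.mk_surjective x
    rw [AdjoinRoot.smul_mk, hs', hs', map_smul]; rfl⟩
  have hd : finrank F (AdjoinRoot P) = P.natDegree := by
    rw [(AdjoinRoot.powerBasis hirr.ne_zero).finrank, AdjoinRoot.powerBasis_dim]
  have : FiniteDimensional F (AdjoinRoot P) := (AdjoinRoot.powerBasis hirr.ne_zero).finite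
  have h1 := finrank_mul_finrank F (AdjoinRoot P) V
  have h2 := finrank_mul_finrank F (AdjoinRoot P) V'
  have : FiniteDimensional (AdjoinRoot P) V := Module.Finite.of_restrictScalars_finite F _ _
  have : FiniteDimensional (AdjoinRoot P) V' := Module.Finite.of_restrictScalars_finite F _ _
  refine ⟨⟨_, by rw [← h1, hd]⟩, ?_⟩
  have hpos : 0 < finrank F (AdjoinRoot P) := finrank_pos
  have e : V ≃ₗ[AdjoinRoot P] V' := LinearEquiv.ofFinrankEq _ _
    (Nat.eq_of_mul_eq_mul_left hpos (by rw [h1, h2, hfin]))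
  refine ⟨e.restrictScalars F, LinearMap.ext fun v => ?_⟩
  have h3 : ∀ v, h v = AdjoinRoot.root P • v := fun v => by
    rw [← AdjoinRoot.mk_X, hs, Polynomial.aeval_X]
  have h4 : ∀ v, h' v = AdjoinRoot.root P • v := fun v => by
    rw [← AdjoinRoot.mk_X, hs', Polynomial.aeval_X]
  rw [LinearEquiv.conj_apply_apply, h3, h4]
  change e (AdjoinRoot.root P • e.symm v) = _
  rw [map_smul, LinearEquiv.apply_symm_apply]

theorem exists_aeval_eq_zero [FiniteDimensional F V] {P : Polynomial F} (hirr : Irreducible P)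
    (hd : P.natDegree ∣ finrank F V) : ∃ h : End F V, Polynomial.aeval h P = 0 := by
  have : Fact (Irreducible P) := ⟨hirr⟩
  obtain ⟨m, hm⟩ := hd
  have hd : finrank F (AdjoinRoot P) = P.natDegree := by
    rw [(AdjoinRoot.powerBasis hirr.ne_zero).finrank, AdjoinRoot.powerBasis_dim]
  have : FiniteDimensional F (AdjoinRoot P) := (AdjoinRoot.powerBasis hirr.ne_zero).finite
  have e : (Fin m → AdjoinRoot P) ≃ₗ[F] V := LinearEquiv.ofFinrankEq _ _ (by
    rw [finrank_pi_fintype, hm]; simp [hd, mul_comm])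
  refine ⟨e.conj (Algebra.lsmul F F (Fin m → AdjoinRoot P) (AdjoinRoot.root P)), ?_⟩
  rw [aeval_linearEquiv_conj_eq_zero_iff, Polynomial.aeval_algHom_apply, AdjoinRoot.aeval_eq,
    AdjoinRoot.mk_self, map_zero]

/-- Orbit-stabilizer: the endomorphisms annihilated by `P` form a single conjugacy class, or none,
so summing the orders of their centralizers gives the order of the whole group. -/
theorem totalCentralizer_of_irreducible [Finite V] [FiniteDimensional F V] {P : Polynomial F}
    (hirr : Irreducible P) : totalCentralizer P V =
      if P.natDegree ∣ finrank F V then (Nat.card (V ≃ₗ[F] V) : ℤ) else 0 := by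
  classical
  split_ifs with hd
  · obtain ⟨h₀, hP₀⟩ := exists_aeval_eq_zero hirr hd
    unfold totalCentralizer
    rw [finsum_ite_eq_finsum_subtype]
    have hc : ∀ h : {h : End F V // Polynomial.aeval h P = 0},
        Nat.card (InjectiveCentralizer h.1) = Nat.card {k : V ≃ₗ[F] V //
          (⟨k.conj h₀, (aeval_linearEquiv_conj_eq_zero_iff k h₀ P).2 hP₀⟩ :
            {h : End F V // Polynomial.aeval h P = 0}) = h} := by
      rintro ⟨h, hP⟩
      obtain ⟨-, k₁, rfl⟩ := natDegree_dvd_finrank_and_exists_linearEquiv hirr hP₀ hP rfl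
      symm
      -- The automorphisms conjugating `h₀` to `k₁ h₀ k₁⁻¹` form a coset: `k ↦ k k₁⁻¹` maps them
      -- onto the centralizer of `k₁ h₀ k₁⁻¹`.
      have hcomm : ∀ k : V ≃ₗ[F] V, k.conj h₀ = k₁.conj h₀ ↔
          Commute ((k₁.symm.trans k : V ≃ₗ[F] V) : End F V) (k₁.conj h₀) := by
        intro k
        constructor
        · intro hk
          refine LinearMap.ext fun v => ?_
          have := LinearMap.congr_fun hk (k (k₁.symm v))
          simpa using this
        · intro hk
          refine LinearMap.ext fun v => ?_
          have := LinearMap.congr_fun hk.eq (k₁ (k.symm v))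
          simpa using this
      refine Nat.card_congr (Equiv.ofBijective (fun k => ⟨(k₁.symm.trans k.1 : V ≃ₗ[F] V),
        (k₁.symm.trans k.1).injective, (hcomm k.1).1 (congrArg Subtype.val k.2)⟩) ⟨?_, ?_⟩)
      · intro k k' hkk
        refine Subtype.ext (LinearEquiv.ext fun v => ?_)
        have := LinearMap.congr_fun (congrArg Subtype.val hkk) (k₁ v)
        simpa using this
      · rintro ⟨g, hg, hgc⟩
        refine ⟨⟨k₁.trans (LinearEquiv.ofInjectiveEndo g hg), Subtype.ext ((hcomm _).2 ?_)⟩,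
          Subtype.ext (LinearMap.ext fun v => ?_)⟩
        · convert hgc using 1
          refine LinearMap.ext fun v => ?_
          simp
        · simp
    rw [finsum_congr fun h => congrArg Nat.cast (hc h), ← natCast_card_sigma,
      Nat.card_congr (Equiv.sigmaFiberEquiv _)]
  · refine finsum_eq_zero_of_forall_eq_zero fun h => if_neg fun h0 => hd ?_
    exact (natDegree_dvd_finrank_and_exists_linearEquiv hirr h0 h0 rfl).1

theorem centralizerSeries_mul_of_irreducible [Finite F] {P : Polynomial F}
    (hirr : Irreducible P) : centralizerSeries P * (1 - X ^ P.natDegree) = 1 := by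
  have h : ∀ n, coeff n (centralizerSeries P) = if P.natDegree ∣ n then 1 else 0 := by
    intro n
    rw [centralizerSeries, coeff_mk, totalCentralizer_of_irreducible hirr, finrank_fin_fun]
    have := (cardGL_pos (F := F) n).ne'
    split_ifs
    · change ((cardGL F n : ℤ) : ℚ) / _ = 1
      rw [Int.cast_natCast]
      exact div_self (Nat.cast_ne_zero.2 this)
    · simp
  ext n
  have hpos := hirr.natDegree_pos
  rw [mul_sub, mul_one, map_sub, coeff_mul_X_pow', h, h, PowerSeries.coeff_one]
  rcases lt_or_ge n P.natDegree with hn | hn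
  · rw [if_neg (not_le.2 hn), sub_zero]
    simp only [Nat.dvd_iff_mod_eq_zero, Nat.mod_eq_of_lt hn]
  · rw [if_pos hn, if_neg (by omega : n ≠ 0)]
    simp [Nat.dvd_sub_iff_left hn (dvd_refl _)]

-- Both sides are inverse to `centralizerSeries f`. For the product this follows by splitting off
-- primes one at a time; squarefreeness makes each prime coprime to the remaining factor.
open UniqueFactorizationMonoid in
theorem moebiusSeries_eq_prod [Finite F] [DecidableEq F] {f : Polynomial F} (hf : Squarefree f) :
    moebiusSeries f = ((normalizedFactors f).map fun P => 1 - X ^ P.natDegree).prod := by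
  suffices h : centralizerSeries f *
      ((normalizedFactors f).map fun P => (1 - X ^ P.natDegree : ℚ⟦X⟧)).prod = 1 by
    calc moebiusSeries f = moebiusSeries f * (centralizerSeries f *
        ((normalizedFactors f).map fun P => (1 - X ^ P.natDegree : ℚ⟦X⟧)).prod) := by
          rw [h, mul_one]
      _ = _ := by rw [← mul_assoc, moebiusSeries_mul_centralizerSeries hf, one_mul]
  induction f using UniqueFactorizationMonoid.induction_on_prime with
  | h₁ => exact absurd hf not_squarefree_zero
  | h₂ f hu =>
    rw [centralizerSeries_of_isUnit hu, normalizedFactors_of_isUnit hu]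
    simp
  | h₃ a p ha hp ih =>
    obtain ⟨hrel, -, hsa⟩ := squarefree_mul_iff.1 hf
    rw [centralizerSeries_mul (isRelPrime_iff_isCoprime.1 hrel), normalizedFactors_mul hp.ne_zero ha,
      normalizedFactors_irreducible hp.irreducible, Multiset.map_add, Multiset.prod_add,
      mul_mul_mul_comm, ih hsa, mul_one, Multiset.map_singleton, Multiset.prod_singleton,
      Polynomial.natDegree_eq_of_degree_eq Polynomial.degree_normalize]
    exact centralizerSeries_mul_of_irreducible hp.irreducible

end CentralizerSeries

/-! ### Homomorphisms from `ℤ × ℤ_p` to a finite group. -/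

section PrimaryHomomorphisms

open Module

variable (p : ℕ) [Fact p.Prime]

/-- The generator of the factor `ℤ` of `ℤ × ℤ_p`. -/
noncomputable def PrimaryGroup.intGen : PrimaryGroup p 2 := Multiplicative.ofAdd (1, 0)

/-- The topological generator of the factor `ℤ_p` of `ℤ × ℤ_p`. -/
noncomputable def PrimaryGroup.padicGen : PrimaryGroup p 2 := Multiplicative.ofAdd (0, fun _ => 1)

/-- Writing `m = p ^ k * u` with `u` a `p`-adic unit, the ideals generated by `m` and `p ^ k` agree.
For `m = |G|`, homomorphisms to `G` kill multiples of `m`, so on the factor `ℤ_p` they are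
determined by the image of `1`, which has `p`-power order. -/
theorem exists_padicInt_eq_natCast_add_mul {m : ℕ} (hm : m ≠ 0) :
    ∃ k : ℕ, (∃ y : ℤ_[p], ((p ^ k : ℕ) : ℤ_[p]) = m * y) ∧
      ∀ x : ℤ_[p], ∃ (a : ℕ) (y : ℤ_[p]), x = a + m * y := by
  obtain ⟨k, u, hu, hm⟩ :=
    Nat.exists_eq_pow_mul_and_not_dvd hm p (Fact.out : p.Prime).ne_one
  have hunit : IsUnit ((u : ℕ) : ℤ_[p]) := by
    rw [PadicInt.isUnit_iff]
    by_contra h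
    exact hu ((PadicInt.norm_natCast_lt_one_iff).1 (lt_of_le_of_ne (PadicInt.norm_le_one _) h))
  obtain ⟨v, hv⟩ := hunit.exists_left_inv
  refine ⟨k, ⟨v, ?_⟩, fun x => ?_⟩
  · rw [hm]
    push_cast
    linear_combination -(p : ℤ_[p]) ^ k * hv
  · obtain ⟨z, hz⟩ := Ideal.mem_span_singleton'.1 (PadicInt.appr_spec k x)
    refine ⟨x.appr k, z * v, ?_⟩
    rw [hm]
    push_cast
    linear_combination -hz - z * (p : ℤ_[p]) ^ k * hv

variable {p} {G : Type*} [Group G]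

theorem PrimaryGroup.exists_pow_padicGen_eq_one [Finite G] (f : PrimaryGroup p 2 →* G) :
    ∃ k : ℕ, f (padicGen p) ^ p ^ k = 1 := by
  obtain ⟨k, ⟨y, hy⟩, -⟩ := exists_padicInt_eq_natCast_add_mul p (Nat.card_pos (α := G)).ne'
  have h : padicGen p ^ p ^ k =
      (Multiplicative.ofAdd ((0, fun _ => y) : ℤ × (Fin (2 - 1) → ℤ_[p])) : PrimaryGroup p 2) ^
        Nat.card G := by
    apply Multiplicative.toAdd.injective
    rw [toAdd_pow, toAdd_pow]
    refine Prod.ext (by simp [padicGen]) (funext fun i => ?_)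
    simpa [padicGen] using hy
  exact ⟨k, by rw [← map_pow, h, map_pow, pow_card_eq_one']⟩

theorem PrimaryGroup.exists_hom_apply_eq (G : Type*) [Group G] [Finite G] (x : PrimaryGroup p 2) :
    ∃ (m : ℤ) (a : ℕ), ∀ f : PrimaryGroup p 2 →* G,
      f x = f (intGen p) ^ m * f (padicGen p) ^ a := by
  obtain ⟨k, -, hk⟩ := exists_padicInt_eq_natCast_add_mul p (Nat.card_pos (α := G)).ne'
  obtain ⟨m, w⟩ := x
  obtain ⟨a, y, hay⟩ := hk (w 0)
  refine ⟨m, a, fun f => ?_⟩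
  have hx : (Multiplicative.ofAdd ((m, w) : ℤ × (Fin (2 - 1) → ℤ_[p])) : PrimaryGroup p 2) =
      intGen p ^ m * padicGen p ^ a *
        (Multiplicative.ofAdd ((0, fun _ => y) : ℤ × (Fin (2 - 1) → ℤ_[p])) : PrimaryGroup p 2) ^
          Nat.card G := by
    apply Multiplicative.toAdd.injective
    rw [toAdd_mul, toAdd_mul, toAdd_pow, toAdd_pow, toAdd_zpow]
    refine Prod.ext (by simp [padicGen, intGen]) (funext fun i => ?_)
    obtain rfl : i = 0 := Subsingleton.elim (α := Fin 1) _ _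
    simpa [padicGen, intGen] using hay
  exact (congrArg f hx).trans (by
    rw [map_mul, map_mul, map_zpow, map_pow, map_pow, pow_card_eq_one', mul_one])

/-- Pairs of commuting elements, the second of `p`-power order. -/
abbrev PrimaryCommutingPair (p : ℕ) (G : Type*) [Group G] : Type _ :=
  {x : G × G // Commute x.1 x.2 ∧ ∃ k : ℕ, x.2 ^ p ^ k = 1}

theorem PrimaryGroup.exists_hom (x : PrimaryCommutingPair p G) :
    ∃ f : PrimaryGroup p 2 →* G, f (intGen p) = x.1.1 ∧ f (padicGen p) = x.1.2 := by
  obtain ⟨⟨g, h⟩, hgh, k, hk⟩ := x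
  simp only at hgh hk
  have : NeZero (p ^ k) := ⟨pow_ne_zero _ (Fact.out : p.Prime).ne_zero⟩
  have hmod : ∀ n : ℕ, h ^ (n % p ^ k) = h ^ n := fun n => (pow_eq_pow_mod n hk).symm
  -- The second factor acts through `ℤ_p → ℤ / p ^ k`; the choice of representative is harmless
  -- because `h ^ p ^ k = 1`.
  refine ⟨MonoidHom.mk' (fun x => g ^ (Multiplicative.toAdd x).1 *
    h ^ (PadicInt.toZModPow k ((Multiplicative.toAdd x).2 0)).val) ?_, ?_, ?_⟩
  · intro a b
    rw [toAdd_mul, Prod.fst_add, Prod.snd_add, Pi.add_apply, map_add, ZMod.val_add, hmod, zpow_add,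
      pow_add]
    have := (hgh.zpow_left (Multiplicative.toAdd b).1).pow_right
      (PadicInt.toZModPow k ((Multiplicative.toAdd a).2 0)).val
    rw [mul_assoc, mul_assoc, ← mul_assoc (h ^ _) (g ^ _), ← this.eq, mul_assoc]
  · simp [intGen]
  · simp [padicGen, ZMod.val_one_eq_one_mod, hmod]

/-- Homomorphisms from `ℤ × ℤ_p` to a finite group are pairs of commuting elements, the second of
`p`-power order. -/
noncomputable def PrimaryGroup.homEquiv [Finite G] : (PrimaryGroup p 2 →* G) ≃ PrimaryCommutingPair p G :=
  Equiv.ofBijective (fun f => ⟨(f (intGen p), f (padicGen p)),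
    (Commute.all (intGen p) (padicGen p)).map f, exists_pow_padicGen_eq_one f⟩) ⟨by
      intro f f' hff
      simp only [Subtype.mk.injEq, Prod.mk.injEq] at hff
      refine MonoidHom.ext fun x => ?_
      obtain ⟨m, a, h⟩ := exists_hom_apply_eq G x
      rw [h, h, hff.1, hff.2], fun x => by
      obtain ⟨f, h1, h2⟩ := exists_hom x
      exact ⟨f, Subtype.ext (Prod.ext h1 h2)⟩⟩

theorem PrimaryGroup.mem_fixedPoints_range_iff [Finite G] {A : Type*} [MulAction G A]
    (f : PrimaryGroup p 2 →* G) (a : A) :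
    a ∈ MulAction.fixedPoints f.range A ↔ f (intGen p) • a = a ∧ f (padicGen p) • a = a := by
  constructor
  · intro h
    exact ⟨h ⟨_, _, rfl⟩, h ⟨_, _, rfl⟩⟩
  · rintro ⟨h1, h2⟩ ⟨_, x, rfl⟩
    obtain ⟨m, n, h⟩ := exists_hom_apply_eq G x
    change f x • a = a
    have h3 : f (intGen p) ^ m ∈ MulAction.stabilizer G a := Subgroup.zpow_mem _ h1 m
    have h4 : f (padicGen p) ^ n ∈ MulAction.stabilizer G a := Subgroup.pow_mem _ h2 n
    rw [h]
    exact mul_mem h3 h4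

end PrimaryHomomorphisms

/-! ### From equivariant Euler characteristics to `moebiusSeries`. -/

section PrimaryGeneratingFunction

open Module

variable {F V : Type*} [Field F] [AddCommGroup V] [Module F V]

theorem smul_properSubspace_eq_iff [Finite V] (g : LinearMap.GeneralLinearGroup F V)
    (U : ProperSubspace F V) : g • U = U ↔ U.1 ∈ End.invtSubmodule (g : End F V) := by
  rw [End.mem_invtSubmodule_iff_map_le, Subtype.ext_iff]
  change U.1.map (g : End F V) = U.1 ↔ _
  constructor
  · exact fun h => h.le
  · intro h
    have : FiniteDimensional F V := Module.Finite.of_finite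
    have hinj : Function.Injective (g : End F V) := ((End.isUnit_iff _).1 g.isUnit).1
    exact Submodule.eq_of_le_of_finrank_eq h
      (Submodule.equivMapOfInjective _ hinj U.1).symm.finrank_eq

theorem reducedEulerChar_fixedPoints [Finite V] [Nontrivial V] {p : ℕ} [Fact p.Prime]
    (f : PrimaryGroup p 2 →* LinearMap.GeneralLinearGroup F V) :
    reducedEulerChar (MulAction.fixedPoints f.range (ProperSubspace F V)) =
      invariantMoebius (f (PrimaryGroup.intGen p) : End F V)
        (f (PrimaryGroup.padicGen p) : End F V) := by
  rw [invariantMoebius, if_neg (not_subsingleton V)]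
  have key : ∀ U : ProperSubspace F V, U ∈ MulAction.fixedPoints f.range (ProperSubspace F V) ↔
      U.1 ∈ End.invtSubmodule (f (PrimaryGroup.intGen p) : End F V) ∧
      U.1 ∈ End.invtSubmodule (f (PrimaryGroup.padicGen p) : End F V) := fun U => by
    rw [PrimaryGroup.mem_fixedPoints_range_iff, smul_properSubspace_eq_iff,
      smul_properSubspace_eq_iff]
  exact reducedEulerChar_congr
    { toFun := fun U => ⟨U.1.1, U.1.2, (key U.1).1 U.2⟩
      invFun := fun U => ⟨⟨U.1, U.2.1⟩, (key ⟨U.1, U.2.1⟩).2 U.2.2⟩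
      left_inv := fun _ => rfl
      right_inv := fun _ => rfl
      map_rel_iff' := Iff.rfl }

/-- The order is some `p ^ j` with `j < p ^ j ≤ |G| ≤ N`. This makes one exponent serve all elements
of `p`-power order. -/
theorem pow_prime_pow_eq_one_of_card_le {G : Type*} [Group G] [Finite G] {p : ℕ} (hp : p.Prime)
    {h : G} {k N : ℕ} (hk : h ^ p ^ k = 1) (hN : Nat.card G ≤ N) : h ^ p ^ N = 1 := by
  obtain ⟨j, -, hj⟩ := (Nat.dvd_prime_pow hp).1 (orderOf_dvd_of_pow_eq_one hk)
  rw [← orderOf_dvd_iff_pow_eq_one, hj]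
  refine pow_dvd_pow p ?_
  have h1 : j < p ^ j := Nat.lt_pow_self hp.one_lt
  have h2 : orderOf h ≤ Nat.card G := orderOf_le_card
  omega

theorem finsum_primaryGroup_eq_totalMoebius [Finite V] [Nontrivial V]
    {p : ℕ} [Fact p.Prime] {N : ℕ} (hN : Nat.card (LinearMap.GeneralLinearGroup F V) ≤ N) :
    ∑ᶠ f : PrimaryGroup p 2 →* LinearMap.GeneralLinearGroup F V,
      reducedEulerChar (MulAction.fixedPoints f.range (ProperSubspace F V)) =
    totalMoebius (Polynomial.X ^ p ^ N - 1 : Polynomial F) V := by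
  classical
  have hfin : Finite (LinearMap.GeneralLinearGroup F V) := inferInstanceAs (Finite (End F V)ˣ)
  rw [finsum_congr reducedEulerChar_fixedPoints]
  refine (finsum_comp_equiv (PrimaryGroup.homEquiv (p := p) (G := LinearMap.GeneralLinearGroup F V))
    (f := fun x => invariantMoebius (x.1.1 : End F V) (x.1.2 : End F V))).trans ?_
  unfold totalMoebius centralizerMoebius
  rw [finsum_ite_eq_finsum_subtype, ← finsum_sigma_of_finite
    (fun x : Σ h : {h : End F V // Polynomial.aeval h (Polynomial.X ^ p ^ N - 1 : Polynomial F) = 0},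
      InjectiveCentralizer h.1 => invariantMoebius x.2.1 x.1.1)]
  have haeval : ∀ h : End F V, Polynomial.aeval h (Polynomial.X ^ p ^ N - 1 : Polynomial F) = 0 ↔
      h ^ p ^ N = 1 := fun h => by simp [sub_eq_zero]
  have hpow : ∀ x : PrimaryCommutingPair p (LinearMap.GeneralLinearGroup F V), x.1.2 ^ p ^ N = 1 := fun x => by
    obtain ⟨k, hk⟩ := x.2.2
    exact pow_prime_pow_eq_one_of_card_le Fact.out hk hN
  let Φ : PrimaryCommutingPair p (LinearMap.GeneralLinearGroup F V) → Σ h : {h : End F V //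
      Polynomial.aeval h (Polynomial.X ^ p ^ N - 1 : Polynomial F) = 0},
      InjectiveCentralizer h.1 := fun x => ⟨⟨x.1.2, (haeval _).2 (by
        rw [← Units.val_pow_eq_pow_val, hpow x, Units.val_one])⟩,
      ⟨x.1.1, ((End.isUnit_iff _).1 x.1.1.isUnit).1, x.2.1.map (Units.coeHom _)⟩⟩
  have hΦ : Function.Bijective Φ := by
    constructor
    · intro x y hxy
      refine Subtype.ext (Prod.ext (Units.ext ?_) (Units.ext ?_))
      · exact congrArg (fun z => z.2.1) hxy
      · exact congrArg (fun z => z.1.1) hxy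
    · rintro ⟨⟨h, hh⟩, ⟨g, hg, hgh⟩⟩
      have hh' := (haeval h).1 hh
      have hu : IsUnit h := IsUnit.of_pow_eq_one hh' (pow_ne_zero _ (Fact.out : p.Prime).ne_zero)
      have hgu : IsUnit g := (End.isUnit_iff _).2 (Finite.injective_iff_bijective.1 hg)
      obtain ⟨h, rfl⟩ := hu
      obtain ⟨g, rfl⟩ := hgu
      refine ⟨⟨(g, h), Units.ext hgh.eq, N, Units.ext ?_⟩, rfl⟩
      rw [Units.val_pow_eq_pow_val, hh', Units.val_one]
  rw [← finsum_comp Φ hΦ]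

/-- The bound on `N` depends on the degree `n`, so the generating function is only a coefficientwise
limit of the polynomial series. -/
theorem coeff_primaryGenFun [Finite F] (p : ℕ) [Fact p.Prime] (n : ℕ) :
    ∃ N₀, ∀ N, N₀ ≤ N → coeff n (primaryGenFun p 2 F) =
      coeff n (moebiusSeries (Polynomial.X ^ p ^ N - 1 : Polynomial F)) := by
  refine ⟨Nat.card (LinearMap.GeneralLinearGroup F (Fin n → F)), fun N hN => ?_⟩
  rw [primaryGenFun, moebiusSeries, coeff_mk, coeff_mk]
  split_ifs with hn
  · subst hn
    rw [totalMoebius_of_subsingleton, cardGL_zero]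
    simp
  · have : NeZero n := ⟨hn⟩
    have hfin : Finite (LinearMap.GeneralLinearGroup F (Fin n → F)) :=
      inferInstanceAs (Finite (End F (Fin n → F))ˣ)
    have := finite_primaryGroup_hom p 2 (LinearMap.GeneralLinearGroup F (Fin n → F))
    have := Fintype.ofFinite (PrimaryGroup p 2 →* LinearMap.GeneralLinearGroup F (Fin n → F))
    rw [primaryEquivariantEulerChar, ← finsum_primaryGroup_eq_totalMoebius hN, cardGL,
      Nat.card_congr (LinearMap.GeneralLinearGroup.generalLinearEquiv F (Fin n → F)).toEquiv,
      finsum_eq_sum_of_fintype, finsum_eq_sum_of_fintype, Int.cast_sum, div_eq_inv_mul]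

end PrimaryGeneratingFunction

/-! ### Partitions into powers of `p`. -/

section PowerPartitions

theorem powerPartitionGenFun_eq_mk_card_restricted (p : ℕ) [DecidablePred fun i => ∃ k, i = p ^ k] :
    powerPartitionGenFun p = PowerSeries.mk fun n =>
      ((Nat.Partition.restricted n fun i => ∃ k, i = p ^ k).card : ℚ) := by
  unfold powerPartitionGenFun Nat.Partition.restricted
  congr 1
  funext n
  rw [Nat.card_eq_fintype_card, Fintype.card_subtype]

theorem X_pow_dvd_prod_sub_one {ι : Type*} (s : Finset ι) (f : ι → ℚ⟦X⟧) {n : ℕ}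
    (h : ∀ i ∈ s, X ^ n ∣ f i - 1) : X ^ n ∣ ∏ i ∈ s, f i - 1 := by
  classical
  induction s using Finset.induction_on with
  | empty => simp
  | insert i s hi ih =>
    rw [Finset.prod_insert hi,
      show f i * ∏ i ∈ s, f i - 1 = f i * (∏ i ∈ s, f i - 1) + (f i - 1) by ring]
    exact dvd_add ((ih fun j hj => h j (Finset.mem_insert_of_mem hj)).mul_left _)
      (h i (Finset.mem_insert_self i s))

-- A truncated form of Euler's product: the factors omitted from the finite product are all
-- congruent to `1` modulo `X ^ p ^ m`.
open PowerSeries.WithPiTopology in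
theorem X_pow_dvd_powerPartitionGenFun_mul_prod_sub_one {p : ℕ} (hp : 1 < p) (m : ℕ) :
    X ^ p ^ m ∣ powerPartitionGenFun p * ∏ k ∈ Finset.range m, (1 - X ^ p ^ k) - 1 := by
  classical
  rw [powerPartitionGenFun_eq_mk_card_restricted]
  set P : ℚ⟦X⟧ := PowerSeries.mk fun n =>
    ((Nat.Partition.restricted n fun i => ∃ k, i = p ^ k).card : ℚ) with hP
  have hprod := Nat.Partition.hasProd_powerSeriesMk_card_restricted ℚ (fun i => ∃ k, i = p ^ k)
  rw [← hP] at hprod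
  set f : ℕ → ℚ⟦X⟧ := fun i => if ∃ k, i + 1 = p ^ k then ∑' j : ℕ, X ^ ((i + 1) * j) else 1 with hf
  have hf1 : ∀ i, (∃ k, i + 1 = p ^ k) → f i * (1 - X ^ (i + 1)) = 1 := by
    intro i hi
    rw [hf]
    simp only [if_pos hi, pow_mul]
    exact tsum_pow_mul_one_sub_of_constantCoeff_eq_zero (by simp)
  have hf2 : ∀ i, p ^ m ≤ i + 1 → X ^ p ^ m ∣ f i - 1 := by
    intro i hi
    by_cases hk : ∃ k, i + 1 = p ^ k
    · have : f i - 1 = X ^ (i + 1) * f i := by linear_combination hf1 i hk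
      rw [this]
      exact (pow_dvd_pow X hi).mul_right _
    · simp only [hf, if_neg hk, sub_self, dvd_zero]
  -- In the product formula the index `i` stands for the part size `i + 1`, hence the shift by one.
  let T : Finset ℕ := (Finset.range m).image fun k => p ^ k - 1
  have hpk : ∀ k, p ^ k - 1 + 1 = p ^ k := fun k => Nat.sub_add_cancel (Nat.pow_pos (by omega))
  have hinj : Function.Injective fun k => p ^ k - 1 := by
    intro k l hkl
    have : p ^ k = p ^ l := by rw [← hpk k, ← hpk l]; exact congrArg (· + 1) hkl
    exact Nat.pow_right_injective hp this
  have hT : (∏ i ∈ T, f i) * ∏ k ∈ Finset.range m, (1 - X ^ p ^ k) = 1 := by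
    rw [Finset.prod_image hinj.injOn, ← Finset.prod_mul_distrib]
    refine Finset.prod_eq_one fun k _ => ?_
    have := hf1 (p ^ k - 1) ⟨k, hpk k⟩
    rwa [hpk] at this
  have hdvd : ∀ s, T ⊆ s →
      X ^ p ^ m ∣ (∏ i ∈ s, f i) * ∏ k ∈ Finset.range m, (1 - X ^ p ^ k) - 1 := by
    intro s hs
    rw [← Finset.prod_sdiff hs, mul_assoc, hT, mul_one]
    refine X_pow_dvd_prod_sub_one _ _ fun i hi => ?_
    rw [Finset.mem_sdiff] at hi
    by_cases hk : ∃ k, i + 1 = p ^ k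
    · refine hf2 i ?_
      obtain ⟨k, hk⟩ := hk
      rw [hk]
      refine Nat.pow_le_pow_right (by omega) (not_lt.1 fun hkm => hi.2 ?_)
      exact Finset.mem_image.2 ⟨k, Finset.mem_range.2 hkm, by omega⟩
    · simp only [hf, if_neg hk, sub_self, dvd_zero]
  rw [PowerSeries.X_pow_dvd_iff]
  intro l hl
  have hlim : Filter.Tendsto (fun s : Finset ℕ =>
      coeff l ((∏ i ∈ s, f i) * ∏ k ∈ Finset.range m, (1 - X ^ p ^ k) - 1)) Filter.atTop
      (nhds (coeff l (P * ∏ k ∈ Finset.range m, (1 - X ^ p ^ k) - 1))) := by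
    have h1 : Filter.Tendsto (fun s : Finset ℕ => ∏ i ∈ s, f i) Filter.atTop (nhds P) := hprod
    exact ((PowerSeries.WithPiTopology.continuous_coeff ℚ l).tendsto _).comp
      ((h1.mul_const _).sub_const 1)
  -- For index sets containing `T` the coefficients below degree `p ^ m` no longer change, so they
  -- equal their limit.
  refine tendsto_nhds_unique hlim (tendsto_const_nhds.congr' ?_)
  filter_upwards [Filter.eventually_ge_atTop T] with s hs
  exact (PowerSeries.X_pow_dvd_iff.1 (hdvd s hs) l hl).symm

theorem constantCoeff_powerPartitionGenFun_ne_zero {p : ℕ} (hp : 1 < p) :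
    constantCoeff (powerPartitionGenFun p) ≠ 0 := by
  have h := PowerSeries.X_pow_dvd_iff.1
    (X_pow_dvd_powerPartitionGenFun_mul_prod_sub_one hp 0) 0 (by simp)
  simp only [Finset.range_zero, Finset.prod_empty, mul_one, map_sub, coeff_zero_eq_constantCoeff,
    map_one, sub_eq_zero] at h
  rw [h]
  exact one_ne_zero

end PowerPartitions

/-! ### Irreducible factors of cyclotomic polynomials over a finite field. -/

section CyclotomicFactors

open Polynomial UniqueFactorizationMonoid

variable {F : Type*} [Field F] [Finite F]

theorem natDegree_of_irreducible_of_dvd_cyclotomic {n : ℕ} (hn : (Nat.card F).Coprime n)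
    {P : Polynomial F} (hP : P ∣ cyclotomic n F) (hirr : Irreducible P) :
    P.natDegree = orderOf ((Nat.card F : ℕ) : ZMod n) := by
  have := Fintype.ofFinite F
  obtain ⟨p, -, f, hp, hcard⟩ := FiniteField.card' F
  have : Fact p.Prime := ⟨hp⟩
  rw [Nat.card_eq_fintype_card, hcard] at hn ⊢
  have hpn := Nat.Coprime.coprime_dvd_left (dvd_pow_self p f.ne_zero) hn
  rw [natDegree_of_dvd_cyclotomic_of_irreducible hcard hpn hP hirr, ← orderOf_units,
    ZMod.coe_unitOfCoprime]

theorem natCast_ne_zero_of_coprime_card {n : ℕ} (hn : (Nat.card F).Coprime n) : (n : F) ≠ 0 := by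
  have := Fintype.ofFinite F
  obtain ⟨p, hchar, f, hp, hcard⟩ := FiniteField.card' F
  rw [Nat.card_eq_fintype_card, hcard] at hn
  have hpn := Nat.Coprime.coprime_dvd_left (dvd_pow_self p f.ne_zero) hn
  rw [Ne, CharP.cast_eq_zero_iff F p]
  exact fun h => hp.one_lt.ne' (Nat.Coprime.eq_one_of_dvd hpn h)

/-- All irreducible factors have the same degree `d` and the degrees add up to `φ(n)`, so there are
`φ(n) / d` of them. -/
theorem prod_normalizedFactors_cyclotomic [DecidableEq F] {n : ℕ} (hn : (Nat.card F).Coprime n) :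
    ((normalizedFactors (cyclotomic n F)).map fun P => (1 - PowerSeries.X ^ P.natDegree : ℚ⟦X⟧)).prod
      = (1 - PowerSeries.X ^ orderOf ((Nat.card F : ℕ) : ZMod n)) ^
        (n.totient / orderOf ((Nat.card F : ℕ) : ZMod n)) := by
  set d := orderOf ((Nat.card F : ℕ) : ZMod n) with hd
  have hne := cyclotomic_ne_zero n F
  have hdeg : ∀ P ∈ normalizedFactors (cyclotomic n F), P.natDegree = d := fun P hP =>
    natDegree_of_irreducible_of_dvd_cyclotomic hn (dvd_of_mem_normalizedFactors hP)
      (irreducible_of_normalized_factor P hP)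
  have hsum : (normalizedFactors (cyclotomic n F)).card * d = n.totient := by
    rw [← natDegree_cyclotomic n F, ← natDegree_eq_of_degree_eq
      (degree_eq_degree_of_associated (prod_normalizedFactors hne)), natDegree_multiset_prod _
        (zero_notMem_normalizedFactors _), Multiset.map_congr rfl hdeg]
    simp
  rw [Multiset.map_congr rfl (fun P hP => by rw [hdeg P hP]), Multiset.map_const',
    Multiset.prod_replicate]
  rcases Nat.eq_zero_or_pos d with h0 | h0
  · rw [h0, mul_zero, eq_comm, Nat.totient_eq_zero] at hsum
    rw [hsum, Nat.coprime_zero_right] at hn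
    exact absurd hn Finite.one_lt_card.ne'
  · rw [← hsum, Nat.mul_div_cancel _ h0]

theorem moebiusSeries_X_pow_prime_pow_sub_one {p : ℕ} [Fact p.Prime] (hp : (Nat.card F).Coprime p)
    (N : ℕ) : moebiusSeries (Polynomial.X ^ p ^ N - 1 : Polynomial F) =
      ∏ j ∈ Finset.range (N + 1), (1 - PowerSeries.X ^ orderOf ((Nat.card F : ℕ) : ZMod (p ^ j))) ^
        ((p ^ j).totient / orderOf ((Nat.card F : ℕ) : ZMod (p ^ j))) := by
  classical
  have hpF : ∀ N, ((p ^ N : ℕ) : F) ≠ 0 :=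
    fun N => natCast_ne_zero_of_coprime_card (hp.pow_right N)
  have hsq : ∀ N, Squarefree (Polynomial.X ^ p ^ N - 1 : Polynomial F) := fun N =>
    ((X_pow_sub_one_separable_iff).2 (hpF N)).squarefree
  induction N with
  | zero =>
    rw [moebiusSeries_eq_prod (hsq 0), zero_add, Finset.prod_range_one,
      ← prod_normalizedFactors_cyclotomic (hp.pow_right 0)]
    simp
  | succ N ih =>
    rw [Finset.prod_range_succ, ← ih, moebiusSeries_eq_prod (hsq _), moebiusSeries_eq_prod (hsq _),
      ← cyclotomic_prime_pow_mul_X_pow_sub_one, normalizedFactors_mul (cyclotomic_ne_zero _ _)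
        (hsq N).ne_zero, Multiset.map_add, Multiset.prod_add,
      prod_normalizedFactors_cyclotomic (hp.pow_right _), mul_comm]

end CyclotomicFactors

/-! ### `p`-adic equivalence and reduction modulo powers of `p`. -/

section PAdicEquivalence

variable {p : ℕ} [Fact p.Prime]

theorem continuous_toZModPow (n : ℕ) :
    Continuous (PadicInt.toZModPow n : ℤ_[p] →+* ZMod (p ^ n)) := by
  refine IsLocallyConstant.continuous ((IsLocallyConstant.iff_eventually_eq _).2 fun x => ?_)
  have hpos : (0 : ℝ) < (p : ℝ) ^ (-n : ℤ) :=
    zpow_pos (by exact_mod_cast (Fact.out : p.Prime).pos) _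
  filter_upwards [Metric.closedBall_mem_nhds x hpos] with y hy
  rw [Metric.mem_closedBall, dist_eq_norm, PadicInt.norm_le_pow_iff_mem_span_pow,
    ← PadicInt.ker_toZModPow, RingHom.mem_ker, map_sub, sub_eq_zero] at hy
  exact hy

/-- Reduction modulo `p ^ n` of `p`-adic units. -/
noncomputable def padicUnitsReduction (p : ℕ) [Fact p.Prime] (n : ℕ) :
    ℤ_[p]ˣ →* (ZMod (p ^ n))ˣ := Units.map (PadicInt.toZModPow n : ℤ_[p] →+* ZMod (p ^ n))

/-- The topology on the units is the one defined by the reductions modulo `p ^ n`, so lying in the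
closure can be tested at each finite level. -/
theorem closure_zpowers_le_iff {u v : ℤ_[p]ˣ} :
    closure (Subgroup.zpowers u : Set ℤ_[p]ˣ) ⊆ closure (Subgroup.zpowers v : Set ℤ_[p]ˣ) ↔
      ∀ n, padicUnitsReduction p n u ∈ Subgroup.zpowers (padicUnitsReduction p n v) := by
  constructor
  · intro h n
    have hu := h (subset_closure (Subgroup.mem_zpowers u))
    let T : Set (ZMod (p ^ n)) := {x | ∃ m : ℤ, ((padicUnitsReduction p n v ^ m : (ZMod (p ^ n))ˣ) :
      ZMod (p ^ n)) = x}
    have hclosed : IsClosed {x : ℤ_[p]ˣ | PadicInt.toZModPow n (x : ℤ_[p]) ∈ T} :=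
      (isClosed_discrete T).preimage ((continuous_toZModPow n).comp Units.continuous_val)
    have hsub : closure (Subgroup.zpowers v : Set ℤ_[p]ˣ) ⊆
        {x : ℤ_[p]ˣ | PadicInt.toZModPow n (x : ℤ_[p]) ∈ T} := by
      refine closure_minimal ?_ hclosed
      rintro _ ⟨m, rfl⟩
      refine ⟨m, ?_⟩
      rw [← map_zpow]
      rfl
    obtain ⟨m, hm⟩ := hsub hu
    exact ⟨m, Units.ext hm⟩
  · intro h
    refine closure_minimal ?_ isClosed_closure
    rintro _ ⟨k, rfl⟩
    change u ^ k ∈ _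
    have hex : ∀ n, ∃ m : ℤ, padicUnitsReduction p n (v ^ m) = padicUnitsReduction p n (u ^ k) := by
      intro n
      obtain ⟨m, hm⟩ := h n
      exact ⟨m * k, by rw [zpow_mul, map_zpow, map_zpow, map_zpow]; exact congrArg (· ^ k) hm⟩
    choose m hm using hex
    have hp1 : (1 : ℝ) < p := by exact_mod_cast (Fact.out : p.Prime).one_lt
    have hlim : ∀ a : ℕ → ℤ_[p], ∀ b, (∀ n, PadicInt.toZModPow n (a n) = PadicInt.toZModPow n b) →
        Filter.Tendsto a Filter.atTop (nhds b) := by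
      intro a b hab
      rw [tendsto_iff_norm_sub_tendsto_zero]
      refine squeeze_zero (fun _ => norm_nonneg _) (g := fun n => ((p : ℝ)⁻¹) ^ n) (fun n => ?_)
        (tendsto_pow_atTop_nhds_zero_of_lt_one (by positivity) (inv_lt_one_of_one_lt₀ hp1))
      have : ‖a n - b‖ ≤ (p : ℝ) ^ (-n : ℤ) := by
        rw [PadicInt.norm_le_pow_iff_mem_span_pow, ← PadicInt.ker_toZModPow, RingHom.mem_ker,
          map_sub, sub_eq_zero, hab]
      rwa [zpow_neg, zpow_natCast, ← inv_pow] at this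
    refine mem_closure_of_tendsto (f := fun n => v ^ m n) (b := Filter.atTop) ?_
      (Filter.Eventually.of_forall fun n => ⟨m n, rfl⟩)
    -- The unit topology is induced by `u ↦ (u, u⁻¹)`, so the inverses must converge too.
    rw [Units.isInducing_embedProduct.tendsto_nhds_iff]
    refine Filter.Tendsto.prodMk_nhds (hlim _ _ fun n => ?_)
      ((MulOpposite.continuous_op.tendsto _).comp (hlim (fun n => ((v ^ m n)⁻¹ : ℤ_[p]ˣ)) _ fun n => ?_))
    · exact congrArg Units.val (hm n)
    · have := congrArg (fun x => ((x⁻¹ : (ZMod (p ^ n))ˣ) : ZMod (p ^ n))) (hm n)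
      simp only [← map_inv] at this
      exact this

theorem PAdicEquivalent.orderOf_eq {a b : ℤ} (h : PAdicEquivalent p a b) (n : ℕ) :
    orderOf (a : ZMod (p ^ n)) = orderOf (b : ZMod (p ^ n)) := by
  obtain ⟨u, v, hu, hv, huv⟩ := h
  have h1 : ((padicUnitsReduction p n u : (ZMod (p ^ n))ˣ) : ZMod (p ^ n)) = a := by
    change PadicInt.toZModPow n (u : ℤ_[p]) = a
    rw [hu, map_intCast]
  have h2 : ((padicUnitsReduction p n v : (ZMod (p ^ n))ˣ) : ZMod (p ^ n)) = b := by
    change PadicInt.toZModPow n (v : ℤ_[p]) = b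
    rw [hv, map_intCast]
  rw [← h1, ← h2, orderOf_units, orderOf_units]
  exact Nat.dvd_antisymm (orderOf_dvd_of_mem_zpowers (closure_zpowers_le_iff.1 huv.le n))
    (orderOf_dvd_of_mem_zpowers (closure_zpowers_le_iff.1 huv.ge n))

theorem isCoprime_of_units_val_eq {a : ℤ} {u : ℤ_[p]ˣ} (h : (u : ℤ_[p]) = a) :
    IsCoprime a p := by
  rw [← PadicInt.norm_intCast_eq_one_iff, ← h]
  exact PadicInt.norm_units u

theorem pAdicEquivalent_of_forall_exists_dvd {a b : ℤ} (ha : IsCoprime a p) (hb : IsCoprime b p)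
    (hab : ∀ n : ℕ, ∃ t : ℕ, (p : ℤ) ^ n ∣ a - b ^ t)
    (hba : ∀ n : ℕ, ∃ t : ℕ, (p : ℤ) ^ n ∣ b - a ^ t) : PAdicEquivalent p a b := by
  rw [← PadicInt.norm_intCast_eq_one_iff, ← PadicInt.isUnit_iff] at ha hb
  obtain ⟨u, hu⟩ := ha
  obtain ⟨v, hv⟩ := hb
  have key : ∀ {a b : ℤ} {u v : ℤ_[p]ˣ}, (u : ℤ_[p]) = a → (v : ℤ_[p]) = b →
      (∀ n : ℕ, ∃ t : ℕ, (p : ℤ) ^ n ∣ a - b ^ t) →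
      closure (Subgroup.zpowers u : Set ℤ_[p]ˣ) ⊆ closure (Subgroup.zpowers v : Set ℤ_[p]ˣ) := by
    intro a b u v hu hv hab
    refine closure_zpowers_le_iff.2 fun n => ?_
    obtain ⟨t, ht⟩ := hab n
    refine ⟨t, Units.ext ?_⟩
    change ((padicUnitsReduction p n v ^ (t : ℤ) : (ZMod (p ^ n))ˣ) : ZMod (p ^ n)) =
      PadicInt.toZModPow n (u : ℤ_[p])
    rw [zpow_natCast, Units.val_pow_eq_pow_val]
    change PadicInt.toZModPow n (v : ℤ_[p]) ^ t = _
    rw [hu, hv, map_intCast, map_intCast, eq_comm, ← sub_eq_zero, ← Int.cast_pow, ← Int.cast_sub,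
      ZMod.intCast_zmod_eq_zero_iff_dvd]
    exact_mod_cast ht
  exact ⟨u, v, hu, hv, (key hu hv hab).antisymm (key hv hu hba)⟩

end PAdicEquivalence

/-! ### Orders of `±3 ^ 2 ^ e` modulo powers of `2`. -/

section PowersOfThree

/-- Squaring `1 + 2 ^ k c` gives `1 + 2 ^ (k + 1) (c + 2 ^ (k - 1) c ^ 2)`. The new cofactor stays
odd because `k ≥ 2`. -/
theorem exists_odd_pow_two_pow_eq {x c : ℤ} {k : ℕ} (hk : 2 ≤ k) (hc : Odd c)
    (hx : x = 1 + 2 ^ k * c) (i : ℕ) : ∃ d : ℤ, Odd d ∧ x ^ 2 ^ i = 1 + 2 ^ (k + i) * d := by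
  induction i with
  | zero => exact ⟨c, hc, by simpa using hx⟩
  | succ i ih =>
    obtain ⟨d, hd, h⟩ := ih
    obtain ⟨l, rfl⟩ : ∃ l, k = l + 1 + 1 := ⟨k - 2, by omega⟩
    refine ⟨d + 2 ^ (l + 1 + i) * d ^ 2, hd.add_even ?_, ?_⟩
    · exact (even_two.pow_of_ne_zero (by omega)).mul_right _
    · rw [pow_succ 2 i, pow_mul, h]
      ring

theorem exists_odd_three_pow_two_pow_eq (e : ℕ) :
    ∃ c : ℤ, Odd c ∧ (3 : ℤ) ^ 2 ^ (e + 1) = 1 + 2 ^ (e + 3) * c := by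
  obtain ⟨c, hc, h⟩ := exists_odd_pow_two_pow_eq (x := 9) (k := 3) (by omega) odd_one (by norm_num) e
  refine ⟨c, hc, ?_⟩
  rw [pow_succ' 2 e, pow_mul, add_comm e 3, ← h]
  norm_num

theorem intCast_pow_eq_one_iff (a : ℤ) (n k : ℕ) :
    (a : ZMod (2 ^ n)) ^ k = 1 ↔ (2 : ℤ) ^ n ∣ a ^ k - 1 := by
  rw [← sub_eq_zero, ← Int.cast_pow, ← Int.cast_one, ← Int.cast_sub,
    ZMod.intCast_zmod_eq_zero_iff_dvd]
  push_cast
  rfl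

theorem not_two_pow_succ_dvd_two_pow_mul {c : ℤ} (hc : Odd c) (n : ℕ) :
    ¬ (2 : ℤ) ^ (n + 1) ∣ 2 ^ n * c := by
  rw [pow_succ, mul_dvd_mul_iff_left (by positivity)]
  exact fun h => (Int.not_even_iff_odd.2 hc) (even_iff_two_dvd.2 h)

/-- Squaring removes the sign, after which the exact power of `2` dividing `3 ^ 2 ^ (m + 1) - 1`,
namely `2 ^ (m + 3)`, gives the order. Only `i = 0` sees the sign: there the element itself must
differ from `1`, and for `s = -1`, `e > 0` this is checked modulo `4`. -/
theorem orderOf_mul_three_pow {s : ℤ} (hs : s = 1 ∨ s = -1) (e i : ℕ) :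
    orderOf ((s * 3 ^ 2 ^ e : ℤ) : ZMod (2 ^ (e + 3 + i))) = 2 ^ (i + 1) := by
  have hpow : ∀ i, (s * 3 ^ 2 ^ e) ^ 2 ^ (i + 1) = 3 ^ 2 ^ (e + i + 1) := by
    intro i
    rw [mul_pow, pow_succ' 2 i, pow_mul s, (by rcases hs with rfl | rfl <;> norm_num : s ^ 2 = 1),
      one_pow, one_mul, ← pow_mul]
    congr 1
    ring
  apply orderOf_eq_prime_pow
  · rw [intCast_pow_eq_one_iff]
    cases i with
    | succ i =>
      obtain ⟨c, hc, h⟩ := exists_odd_three_pow_two_pow_eq (e + i)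
      rw [hpow, h, add_sub_cancel_left, show e + 3 + (i + 1) = e + i + 3 + 1 by ring]
      exact not_two_pow_succ_dvd_two_pow_mul hc _
    | zero =>
      cases e with
      | zero => rcases hs with rfl | rfl <;> norm_num
      | succ e =>
        obtain ⟨c, hc, h⟩ := exists_odd_three_pow_two_pow_eq e
        rw [h]
        rcases hs with rfl | rfl
        · rw [pow_zero, pow_one, one_mul, add_sub_cancel_left, add_zero,
            show e + 1 + 3 = e + 3 + 1 by ring]
          exact not_two_pow_succ_dvd_two_pow_mul hc _
        · intro hd
          have h4 : (4 : ℤ) ∣ 2 ^ (e + 1 + 3 + 0) := ⟨2 ^ (e + 2), by ring⟩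
          have h5 := h4.trans hd
          have h6 : (4 : ℤ) ∣ 2 ^ (e + 3) * c := Dvd.dvd.mul_right ⟨2 ^ (e + 1), by ring⟩ c
          rw [pow_zero, pow_one] at h5
          omega
  · obtain ⟨c, hc, h⟩ := exists_odd_three_pow_two_pow_eq (e + i)
    rw [intCast_pow_eq_one_iff, hpow, h, add_sub_cancel_left]
    exact Dvd.dvd.mul_right (pow_dvd_pow 2 (by omega)) c

theorem orderOf_three_pow_eq_one {e n : ℕ} (hn : n ≤ e + 3) :
    orderOf ((3 ^ 2 ^ (e + 1) : ℤ) : ZMod (2 ^ n)) = 1 := by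
  obtain ⟨c, hc, h⟩ := exists_odd_three_pow_two_pow_eq e
  rw [orderOf_eq_one_iff, ← pow_one (Int.cast _), intCast_pow_eq_one_iff, pow_one, h,
    add_sub_cancel_left]
  exact Dvd.dvd.mul_right (pow_dvd_pow 2 hn) c

/-- Since `n + 2 ≤ e + 3`, the element is `-1` in this ring, and `-1 ≠ 1` because `4` divides the
modulus. -/
theorem orderOf_neg_three_pow_eq_two {e n : ℕ} (hn : n ≤ e + 1) :
    orderOf ((-(3 ^ 2 ^ (e + 1)) : ℤ) : ZMod (2 ^ (n + 2))) = 2 := by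
  obtain ⟨c, hc, h⟩ := exists_odd_three_pow_two_pow_eq e
  have h2 : (2 : ℤ) ^ (n + 2) ∣ 3 ^ 2 ^ (e + 1) - 1 := by
    rw [h, add_sub_cancel_left]
    exact Dvd.dvd.mul_right (pow_dvd_pow 2 (by omega)) c
  apply orderOf_eq_prime
  · rw [intCast_pow_eq_one_iff]
    exact h2.trans ⟨3 ^ 2 ^ (e + 1) + 1, by ring⟩
  · rw [← pow_one (Int.cast _), Ne, intCast_pow_eq_one_iff, pow_one]
    intro hd
    have h4 : (4 : ℤ) ∣ 2 ^ (n + 2) := ⟨2 ^ n, by ring⟩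
    have h5 := h4.trans hd
    have h6 := h4.trans h2
    omega

theorem orderOf_intCast_eq_one_of_odd {a : ℤ} (ha : Odd a) {n : ℕ} (hn : n ≤ 1) :
    orderOf (a : ZMod (2 ^ n)) = 1 := by
  rw [orderOf_eq_one_iff, ← pow_one (Int.cast _), intCast_pow_eq_one_iff, pow_one]
  refine (pow_dvd_pow 2 hn).trans ?_
  rw [pow_one]
  exact (ha.sub_odd odd_one).two_dvd

/-- Successive approximation: if `b` agrees with `a ^ t` modulo `2 ^ (k + i)` but not modulo the
next power, multiply `a ^ t` by `a ^ (2 * 2 ^ i) = 1 + 2 ^ (k + i) w` with `w` odd. This changes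
exactly the offending binary digit. -/
theorem exists_two_pow_dvd_sub_pow {a b c : ℤ} {k : ℕ} (hk : 2 ≤ k) (hc : Odd c)
    (ha : a ^ 2 = 1 + 2 ^ k * c) (hab : (2 : ℤ) ^ k ∣ b - a) (n : ℕ) :
    ∃ t : ℕ, (2 : ℤ) ^ n ∣ b - a ^ t := by
  have hodd : Odd a := by
    rw [← Int.odd_pow' two_ne_zero, ha, add_comm]
    exact ((even_two.pow_of_ne_zero (by omega)).mul_right c).add_one
  suffices h : ∀ i : ℕ, ∃ t : ℕ, (2 : ℤ) ^ (k + i) ∣ b - a ^ t by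
    obtain ⟨t, ht⟩ := h n
    exact ⟨t, (pow_dvd_pow 2 (by omega)).trans ht⟩
  intro i
  induction i with
  | zero => exact ⟨1, by simpa using hab⟩
  | succ i ih =>
    obtain ⟨t, z, hz⟩ := ih
    rcases Int.even_or_odd z with hz2 | hz2
    · refine ⟨t, ?_⟩
      rw [hz, ← add_assoc, pow_succ]
      exact mul_dvd_mul_left _ hz2.two_dvd
    · obtain ⟨w, hw, h⟩ := exists_odd_pow_two_pow_eq hk hc ha i
      refine ⟨t + 2 * 2 ^ i, ?_⟩
      have : b - a ^ (t + 2 * 2 ^ i) = 2 ^ (k + i) * (z - a ^ t * w) := by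
        rw [pow_add, pow_mul, h]
        linear_combination hz
      rw [this, ← add_assoc, pow_succ]
      exact mul_dvd_mul_left _ (hz2.sub_odd ((hodd.pow).mul hw)).two_dvd

/-- Dirichlet's theorem gives a prime `q` congruent to `-(3 ^ 2 ^ e)` modulo `2 ^ (e + 3)`. That
precision forces `q ^ 2` to be `1 + 2 ^ (e + 3)` times an odd number as well, so each number is
approximated by powers of the other. -/
theorem exists_isPrimePow_pAdicEquivalent (e : ℕ) :
    ∃ q : ℕ, IsPrimePow q ∧ PAdicEquivalent 2 q (-(3 ^ 2 ^ e)) := by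
  obtain ⟨c, hc, h⟩ := exists_odd_three_pow_two_pow_eq e
  have h2 : (-(3 ^ 2 ^ e : ℤ)) ^ 2 = 1 + 2 ^ (e + 3) * c := by
    rw [← h, neg_sq, ← pow_mul, ← pow_succ]
  have hodd : Odd (-(3 ^ 2 ^ e : ℤ)) := (Odd.pow (by decide)).neg
  have hcop : IsCoprime (-(3 ^ 2 ^ e : ℤ)) ((2 : ℕ) : ℤ) := by
    rw [isCoprime_comm]
    exact Int.isCoprime_two_left.2 hodd
  obtain ⟨q, -, hq, hqa⟩ := Nat.forall_exists_prime_gt_and_zmodEq 0 (q := 2 ^ (e + 3))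
    (by positivity) (by push_cast; exact hcop.pow_right)
  have hd : (2 : ℤ) ^ (e + 3) ∣ q - -(3 ^ 2 ^ e) := by
    have := hqa.symm.dvd
    push_cast at this
    exact this
  obtain ⟨z, hz⟩ := hd
  have hq2 : (q : ℤ) ^ 2 = 1 + 2 ^ (e + 3) * (c + 2 * (z * -(3 ^ 2 ^ e)) + 2 ^ (e + 3) * z ^ 2) := by
    rw [sub_eq_iff_eq_add.1 hz, add_sq, h2]
    ring
  have hc' : Odd (c + 2 * (z * -(3 ^ 2 ^ e)) + 2 ^ (e + 3) * z ^ 2) :=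
    (hc.add_even (even_two_mul _)).add_even
      ((even_two.pow_of_ne_zero (by omega)).mul_right _)
  have hqodd : Odd (q : ℤ) := by
    rw [← Int.odd_pow' two_ne_zero, hq2, add_comm]
    exact ((even_two.pow_of_ne_zero (by omega)).mul_right _).add_one
  refine ⟨q, hq.isPrimePow, pAdicEquivalent_of_forall_exists_dvd ?_ hcop ?_ ?_⟩
  · rw [isCoprime_comm]
    exact Int.isCoprime_two_left.2 hqodd
  · exact fun n => exists_two_pow_dvd_sub_pow (by omega) hc h2 ⟨z, hz⟩ n
  · exact fun n => exists_two_pow_dvd_sub_pow (by omega) hc' hq2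
      ⟨-z, by rw [mul_neg, ← hz, neg_sub]⟩ n

end PowersOfThree

/-! ### The generating function in terms of orders modulo powers of `2`. -/

section Evaluation

variable {F : Type*} [Field F] [Finite F]

theorem PAdicEquivalent.isCoprime_left {p : ℕ} [Fact p.Prime] {a b : ℤ}
    (h : PAdicEquivalent p a b) : IsCoprime a p := by
  obtain ⟨u, -, hu, -⟩ := h
  exact isCoprime_of_units_val_eq hu

theorem moebiusSeries_eq_prod_of_pAdicEquivalent {a : ℤ} (h : PAdicEquivalent 2 (Nat.card F) a)
    (N : ℕ) : moebiusSeries (Polynomial.X ^ 2 ^ N - 1 : Polynomial F) =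
      ∏ j ∈ Finset.range (N + 1),
        (1 - X ^ orderOf (a : ZMod (2 ^ j))) ^ ((2 ^ j).totient / orderOf (a : ZMod (2 ^ j))) := by
  rw [moebiusSeries_X_pow_prime_pow_sub_one (Nat.isCoprime_iff_coprime.1 h.isCoprime_left)]
  refine Finset.prod_congr rfl fun j _ => ?_
  rw [← h.orderOf_eq j, Int.cast_natCast]

theorem dvd_pow_sub_one_of_dvd_sub_one {R : Type*} [CommRing R] {x y : R} (h : x ∣ y - 1) (n : ℕ) :
    x ∣ y ^ n - 1 := by
  simpa using h.trans (sub_dvd_pow_sub_pow y 1 n)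

/-- If the orders of `a` modulo powers of `2` grow regularly from `2 ^ (e + 3)` on, the generating
function is determined by the factors for the smaller powers of `2`. -/
theorem mul_primaryGenFun_mul_pow {a : ℤ} {e : ℕ} (h : PAdicEquivalent 2 (Nat.card F) a)
    (hord : ∀ i, orderOf (a : ZMod (2 ^ (e + 3 + i))) = 2 ^ (i + 1)) {S R : ℚ⟦X⟧}
    (hSR : S * ∏ j ∈ Finset.range (e + 3), (1 - X ^ orderOf (a : ZMod (2 ^ j))) ^
      ((2 ^ j).totient / orderOf (a : ZMod (2 ^ j))) = R * (1 - X) ^ 2 ^ (1 + e)) :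
    S * primaryGenFun 2 2 F * powerPartitionGenFun 2 ^ 2 ^ (1 + e) = R := by
  set P := powerPartitionGenFun 2
  have hdvd : ∀ n, X ^ n ∣ S * primaryGenFun 2 2 F * P ^ 2 ^ (1 + e) - R := by
    intro n
    choose N₀ hN₀ using fun k => coeff_primaryGenFun (F := F) 2 k
    -- A single `m` exceeding all thresholds `N₀ k` with `k < n`, and also making `2 ^ (m + 1)`
    -- larger than `n`.
    let m := n + ∑ k ∈ Finset.range n, N₀ k
    have hF : X ^ n ∣ primaryGenFun 2 2 F -
        moebiusSeries (Polynomial.X ^ 2 ^ (e + 2 + m) - 1 : Polynomial F) := by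
      rw [PowerSeries.X_pow_dvd_iff]
      intro k hk
      have := Finset.single_le_sum (f := N₀) (fun _ _ => Nat.zero_le _) (Finset.mem_range.2 hk)
      rw [map_sub, hN₀ k (e + 2 + m) (by omega), sub_self]
    -- The tail supplies the factors `1 - X ^ 2 ^ k` with `k ≥ 1`; the power of `1 - X` in `hSR` is
    -- the missing factor `k = 0`.
    have hM : S * moebiusSeries (Polynomial.X ^ 2 ^ (e + 2 + m) - 1 : Polynomial F) =
        R * (∏ k ∈ Finset.range (m + 1), (1 - X ^ 2 ^ k)) ^ 2 ^ (1 + e) := by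
      rw [moebiusSeries_eq_prod_of_pAdicEquivalent h, show e + 2 + m + 1 = e + 3 + m by ring,
        Finset.prod_range_add, ← mul_assoc, hSR, Finset.prod_range_succ', pow_zero, pow_one,
        mul_comm _ (1 - X), mul_pow, mul_assoc]
      congr 2
      rw [← Finset.prod_pow]
      refine Finset.prod_congr rfl fun i _ => ?_
      -- The exponent is `2 ^ (e + 2 + i) / 2 ^ (i + 1) = 2 ^ (1 + e)`, independent of `i`.
      rw [hord, show e + 3 + i = e + 2 + i + 1 by ring, Nat.totient_prime_pow_succ Nat.prime_two,
        show e + 2 + i = i + 1 + (1 + e) by ring, pow_add 2 (i + 1)]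
      simp
    have hP : X ^ n ∣ (P * ∏ k ∈ Finset.range (m + 1), (1 - X ^ 2 ^ k)) ^ 2 ^ (1 + e) - 1 := by
      refine dvd_pow_sub_one_of_dvd_sub_one ((pow_dvd_pow X ?_).trans
        (X_pow_dvd_powerPartitionGenFun_mul_prod_sub_one one_lt_two (m + 1))) _
      have := Nat.lt_two_pow_self (n := m + 1)
      omega
    have key : S * primaryGenFun 2 2 F * P ^ 2 ^ (1 + e) - R = S * P ^ 2 ^ (1 + e) *
          (primaryGenFun 2 2 F -
            moebiusSeries (Polynomial.X ^ 2 ^ (e + 2 + m) - 1 : Polynomial F)) +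
        R * ((P * ∏ k ∈ Finset.range (m + 1), (1 - X ^ 2 ^ k)) ^ 2 ^ (1 + e) - 1) := by
      rw [mul_pow]
      linear_combination P ^ 2 ^ (1 + e) * hM
    rw [key]
    exact dvd_add (hF.mul_left _) (hP.mul_left _)
  rw [← sub_eq_zero]
  ext n
  exact PowerSeries.X_pow_dvd_iff.1 (hdvd (n + 1)) n (Nat.lt_succ_self n)

theorem sum_totient_two_pow (n : ℕ) : ∑ j ∈ Finset.range (n + 1), (2 ^ j).totient = 2 ^ n := by
  induction n with
  | zero => simp
  | succ n ih =>
    rw [Finset.sum_range_succ, ih, Nat.totient_prime_pow_succ Nat.prime_two]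
    ring

theorem mul_prod_pow_two_pow {R : Type*} [CommMonoid R] (y : R) (m : ℕ) :
    y * ∏ i ∈ Finset.range m, y ^ 2 ^ i = y ^ 2 ^ m := by
  induction m with
  | zero => simp
  | succ m ih => rw [Finset.prod_range_succ, ← mul_assoc, ih, ← pow_add, pow_succ, mul_two]

theorem eq_mul_inv_pow_of_mul_pow_eq {A B C : ℚ⟦X⟧} {n : ℕ} (hC : constantCoeff C ≠ 0)
    (h : A * C ^ n = B) : A = B * C⁻¹ ^ n := by
  rw [← h, mul_assoc, ← mul_pow, PowerSeries.mul_inv_cancel C hC, one_pow, mul_one]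

end Evaluation

/-! ### The four closed formulas. -/

theorem mainTheorem11 (F : Type*) [Field F] [Finite F] (e : ℕ) :
    (∃ q : ℕ, IsPrimePow q ∧ PAdicEquivalent 2 q (-(3 ^ 2 ^ e))) ∧
    (PAdicEquivalent 2 (Nat.card F) (-(3 ^ 2 ^ e)) →
      (e = 0 → primaryGenFun 2 2 F = (1 - X) ^ 2 * (powerPartitionGenFun 2 ^ 2)⁻¹) ∧
      (0 < e → primaryGenFun 2 2 F =
        (1 - X) * (1 + X)⁻¹ * ((1 + X) * (powerPartitionGenFun 2)⁻¹) ^ 2 ^ (1 + e))) ∧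
    (PAdicEquivalent 2 (Nat.card F) (3 ^ 2 ^ e) →
      (e = 0 → primaryGenFun 2 2 F = (1 - X ^ 2) * (powerPartitionGenFun 2 ^ 2)⁻¹) ∧
      (0 < e → primaryGenFun 2 2 F =
        ((1 - X) * (powerPartitionGenFun 2)⁻¹) ^ 2 ^ (1 + e))) := by
  have hP := constantCoeff_powerPartitionGenFun_ne_zero one_lt_two
  have hP2 : ∀ n, constantCoeff (powerPartitionGenFun 2 ^ n) ≠ 0 := fun n => by
    rw [map_pow]
    exact pow_ne_zero n hP
  have hodd : Odd (3 ^ 2 ^ e : ℤ) := Odd.pow (by decide)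
  refine ⟨exists_isPrimePow_pAdicEquivalent e, fun h => ?_, fun h => ?_⟩
  · have hord : ∀ i, orderOf ((-(3 ^ 2 ^ e) : ℤ) : ZMod (2 ^ (e + 3 + i))) = 2 ^ (i + 1) :=
      fun i => by rw [← neg_one_mul]; exact orderOf_mul_three_pow (Or.inr rfl) e i
    constructor
    · rintro rfl
      refine (PowerSeries.eq_mul_inv_iff_mul_eq (hP2 2)).2 ?_
      have h2 : orderOf ((-(3 ^ 2 ^ 0) : ℤ) : ZMod (2 ^ 2)) = 1 := by
        rw [orderOf_eq_one_iff]
        decide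
      -- As `-3` is `1` modulo `4`, the factors for `j = 0, 1, 2` multiply to `(1 - X) ^ 4`, half of
      -- which is absorbed by the tail.
      have := mul_primaryGenFun_mul_pow (S := 1) (R := (1 - X) ^ 2) h hord (by
        rw [Finset.prod_range_succ, Finset.prod_range_succ, Finset.prod_range_one, h2,
          orderOf_intCast_eq_one_of_odd hodd.neg zero_le_one,
          orderOf_intCast_eq_one_of_odd hodd.neg le_rfl, Nat.totient_prime_pow_succ Nat.prime_two 1]
        simp only [pow_zero, pow_one, Nat.totient_one, Nat.totient_two, Nat.div_one]
        norm_num only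
        ring)
      simpa using this
    · intro he
      obtain ⟨e, rfl⟩ : ∃ k, e = k + 1 := ⟨e - 1, by omega⟩
      have hc : constantCoeff (1 + X : ℚ⟦X⟧) ≠ 0 := by simp
      -- The initial product is `(1 - X) ^ 2 (1 - X ^ 2) ^ (2 ^ (e + 2) - 1)`. Multiplying by `S = 1
      -- + X` completes the second exponent to `2 ^ (e + 2)` and leaves one factor `1 - X`.
      have := mul_primaryGenFun_mul_pow (S := 1 + X)
        (R := (1 - X) * (1 + X) ^ 2 ^ (1 + (e + 1))) h hord (by
        rw [show e + 1 + 3 = 2 + (e + 2) by ring, Finset.prod_range_add, Finset.prod_range_succ,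
          Finset.prod_range_one, orderOf_intCast_eq_one_of_odd hodd.neg zero_le_one,
          orderOf_intCast_eq_one_of_odd hodd.neg le_rfl]
        have hprod : ∏ x ∈ Finset.range (e + 2),
            (1 - X ^ orderOf ((-(3 ^ 2 ^ (e + 1)) : ℤ) : ZMod (2 ^ (2 + x))) : ℚ⟦X⟧) ^
              ((2 ^ (2 + x)).totient / orderOf ((-(3 ^ 2 ^ (e + 1)) : ℤ) : ZMod (2 ^ (2 + x)))) =
            ∏ x ∈ Finset.range (e + 2), (1 - X ^ 2) ^ 2 ^ x := by
          refine Finset.prod_congr rfl fun x hx => ?_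
          rw [Finset.mem_range] at hx
          rw [add_comm 2 x, orderOf_neg_three_pow_eq_two (by omega),
            Nat.totient_prime_pow_succ Nat.prime_two, pow_succ 2 x]
          simp
        rw [hprod, show (1 - X) * (1 + X) ^ 2 ^ (1 + (e + 1)) * (1 - X) ^ 2 ^ (1 + (e + 1)) =
          (1 - X) * (1 - X ^ 2 : ℚ⟦X⟧) ^ 2 ^ (e + 2) by
            rw [mul_assoc, ← mul_pow, show 1 + (e + 1) = e + 2 by ring]
            ring_nf, ← mul_prod_pow_two_pow (1 - X ^ 2) (e + 2)]
        norm_num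
        ring)
      rw [mul_pow, ← mul_assoc]
      refine eq_mul_inv_pow_of_mul_pow_eq hP ?_
      rw [mul_right_comm, PowerSeries.eq_mul_inv_iff_mul_eq hc, ← this]
      ring
  · have hord : ∀ i, orderOf ((3 ^ 2 ^ e : ℤ) : ZMod (2 ^ (e + 3 + i))) = 2 ^ (i + 1) :=
      fun i => by rw [← one_mul (3 ^ 2 ^ e : ℤ)]; exact orderOf_mul_three_pow (Or.inl rfl) e i
    constructor
    · rintro rfl
      refine (PowerSeries.eq_mul_inv_iff_mul_eq (hP2 2)).2 ?_
      have h2 : orderOf ((3 ^ 2 ^ 0 : ℤ) : ZMod (2 ^ 2)) = 2 := by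
        apply orderOf_eq_prime <;> decide
      -- Here `3` has order `2` modulo `4`, so the factor for `j = 2` is `1 - X ^ 2` instead of `(1
      -- - X) ^ 2`.
      have := mul_primaryGenFun_mul_pow (S := 1) (R := 1 - X ^ 2) h hord (by
        rw [Finset.prod_range_succ, Finset.prod_range_succ, Finset.prod_range_one, h2,
          orderOf_intCast_eq_one_of_odd hodd zero_le_one,
          orderOf_intCast_eq_one_of_odd hodd le_rfl, Nat.totient_prime_pow_succ Nat.prime_two 1]
        simp only [pow_zero, pow_one, Nat.totient_one, Nat.totient_two, Nat.div_one]
        norm_num only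
        ring)
      simpa using this
    · intro he
      obtain ⟨e, rfl⟩ : ∃ k, e = k + 1 := ⟨e - 1, by omega⟩
      have := mul_primaryGenFun_mul_pow (S := 1)
        (R := (1 - X) ^ 2 ^ (1 + (e + 1))) h hord (by
        have hprod : ∏ j ∈ Finset.range (e + 1 + 3),
            (1 - X ^ orderOf ((3 ^ 2 ^ (e + 1) : ℤ) : ZMod (2 ^ j)) : ℚ⟦X⟧) ^
              ((2 ^ j).totient / orderOf ((3 ^ 2 ^ (e + 1) : ℤ) : ZMod (2 ^ j))) =
            ∏ j ∈ Finset.range (e + 1 + 3), (1 - X) ^ (2 ^ j).totient := by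
          refine Finset.prod_congr rfl fun j hj => ?_
          rw [Finset.mem_range] at hj
          rw [orderOf_three_pow_eq_one (by omega), Nat.div_one, pow_one]
        -- All initial orders are `1` and the totients sum to `2 ^ (e + 3)`: one half of this
        -- exponent is absorbed by the tail, the other half is `R`.
        rw [hprod, Finset.prod_pow_eq_pow_sum, sum_totient_two_pow, ← pow_add]
        ring)
      rw [mul_pow]
      exact eq_mul_inv_pow_of_mul_pow_eq hP (by rw [← this, one_mul])
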